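/- Let $(Z^n)_{n\ge 1}$, $Z^n=(Z^n_t)_{t\ge 0}$, be independent, identically distributed, symmetric real-valued Lévy processes without Gaussian part on a probability space $(\Omega,\mathcal F,\mathbb P)$, with Lévy measure $\nu$, and let $(\beta_n)_{n\ge 1}$ be a (possibly unbounded) sequence of positive real numbers. Here a Lévy process is a process with stationary independent increments which $\mathbb P$-a.s. starts at $0$ and has càdlàg trajectories. The following conditions are equivalent: (i) $\sum_{n\ge 1}(\beta_n Z^n_{t_0})^2<\infty$, $\mathbb P$-a.s., for some $t_0>0$; (ii) for every $t\ge 0$, $\sum_{n\ge 1}(\beta_n Z^n_t)^2<\infty$, $\mathbb P$-a.s.; (iii) $\displaystyle\sum_{n\ge 1}\Big(\beta_n^2\int_{|y|<1/\beta_n}y^2\,\nu(dy)+\nu(\{|y|\ge 1/\beta_n\})\Big)<\infty.$ For a sequence $\rho=(\rho_n)_{n\ge1}$ of positive numbers, let $l^2_\rho$ be the space of real sequences $x=(x_n)$ with $\sum_{n\ge 1}x_n^2\rho_n^2<\infty$, with inner product $\langle x,y\rangle=\sum_{n\ge 1}x_ny_n\rho_n^2$. If $$\sum_{n\ge 1}\Big((\rho_n\beta_n)^2\int_{|\rho_n\beta_n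 y|<1}y^2\,\nu(dy)+\nu(\{|\rho_n\beta_n y|\ge 1\})\Big)<\infty,$$ then $Z_t=(\beta_nZ^n_t)_{n\ge 1}$, $t\ge 0$, is a Lévy process with values in $l^2_\rho$, i.e. there is an $l^2_\rho$-valued Lévy process $Y$ such that, $\mathbb P$-a.s., $Y_t=(\beta_nZ^n_t)_{n\ge 1}$ for all $t\ge 0$. Moreover, such a sequence $\rho$ always exists. -/

import Mathlib

open MeasureTheory ProbabilityTheory Filter Topology
open scoped NNReal ENNReal

noncomputable section

/-- A càdlàg path: right continuous with left limits. -/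
def IsCadlagPath {E : Type*} [TopologicalSpace E] (x : ℝ≥0 → E) : Prop :=
  ∀ t : ℝ≥0, ContinuousWithinAt x (Set.Ici t) t ∧ ∃ l : E, Tendsto x (𝓝[<] t) (𝓝 l)

/-- `X` is a Lévy process under `P`: it starts almost surely at `0`, has independent and
stationary increments, and almost surely has càdlàg trajectories. -/
structure IsLevyProcess {Ω : Type*} [MeasurableSpace Ω] {E : Type*} [NormedAddCommGroup E]
    [MeasurableSpace E] (X : ℝ≥0 → Ω → E) (P : Measure Ω) : Prop where
  measurable : ∀ t, Measurable (X t)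
  start_zero : ∀ᵐ ω ∂P, X 0 ω = 0
  indep_increments : HasIndepIncrements X P
  stationary_increments : ∀ s t : ℝ≥0,
    IdentDistrib (fun ω => X (s + t) ω - X s ω) (fun ω => X t ω - X 0 ω) P P
  cadlag : ∀ᵐ ω ∂P, IsCadlagPath (fun t => X t ω)

/-- `ν` is a Lévy measure on `ℝ` (such a measure is automatically `σ`-finite). -/
structure IsLevyMeasure (ν : Measure ℝ) : Prop where
  zero_singleton : ν {0} = 0
  lintegral_lt_top : ∫⁻ y, ENNReal.ofReal (min (y ^ 2) 1) ∂ν < ⊤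

/-- The Lévy-Khintchine exponent with Gaussian variance `q`, drift `a` and Lévy measure `ν`. -/
def levyKhintchineExponent (q a : ℝ) (ν : Measure ℝ) (h : ℝ) : ℂ :=
  (q : ℂ) / 2 * (h : ℂ) ^ 2 - Complex.I * (a : ℂ) * (h : ℂ)
    - ∫ y : ℝ, (Complex.exp (Complex.I * (h : ℂ) * (y : ℂ)) - 1
        - Complex.I * (h : ℂ) * (y : ℂ) / (1 + (y : ℂ) ^ 2)) ∂ν

/-- The real process `X` has generating triplet `(q, a, ν)`: the measure `ν` is a Lévy measure
and `E[exp (i h X_t)] = exp (- t ψ(h))`, where `ψ` is the Lévy-Khintchine exponent of the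
triplet. The process has no Gaussian part when `q = 0`. -/
structure HasLevyTriplet {Ω : Type*} [MeasurableSpace Ω] (X : ℝ≥0 → Ω → ℝ) (P : Measure Ω)
    (q a : ℝ) (ν : Measure ℝ) : Prop where
  variance_nonneg : 0 ≤ q
  levyMeasure : IsLevyMeasure ν
  charFun_eq : ∀ (t : ℝ≥0) (h : ℝ),
    charFun (P.map (X t)) h = Complex.exp (-((t : ℝ) : ℂ) * levyKhintchineExponent q a ν h)

/-- `∑ₙ (βₙ² ∫_{|y| < 1/βₙ} y² ν(dy) + ν(|y| ≥ 1/βₙ))`, as an extended nonnegative number. -/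
def truncatedMomentSum (ν : Measure ℝ) (β : ℕ → ℝ) : ℝ≥0∞ :=
  ∑' n, (ENNReal.ofReal (β n ^ 2) * ∫⁻ y in {y : ℝ | |y| < 1 / β n}, ENNReal.ofReal (y ^ 2) ∂ν
    + ν {y : ℝ | 1 / β n ≤ |y|})

/-- A sequence of positive weights. -/
abbrev PosWeight : Type := {ρ : ℕ → ℝ // ∀ n, 0 < ρ n}

theorem summable_weighted_mul {ρ x y : ℕ → ℝ} (hx : Summable fun n => x n ^ 2 * ρ n ^ 2)
    (hy : Summable fun n => y n ^ 2 * ρ n ^ 2) : Summable fun n => x n * y n * ρ n ^ 2 := by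
  refine Summable.of_norm_bounded (hx.add hy) fun n => ?_
  rw [Real.norm_eq_abs, abs_le]
  constructor <;>
    nlinarith [sq_nonneg ((x n + y n) * ρ n), sq_nonneg ((x n - y n) * ρ n),
      sq_nonneg (x n * ρ n), sq_nonneg (y n * ρ n)]

/-- The real sequences `x` with `∑ xₙ² ρₙ² < ∞`, as a linear subspace of all sequences. -/
def weightedL2Submodule (ρ : ℕ → ℝ) : Submodule ℝ (ℕ → ℝ) where
  carrier := {x | Summable fun n => x n ^ 2 * ρ n ^ 2}
  zero_mem' := by simp [summable_zero]
  add_mem' := by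
    intro x y hx hy
    refine ((hx.add hy).add ((summable_weighted_mul hx hy).mul_left 2)).congr fun n => ?_
    simp only [Pi.add_apply]
    ring
  smul_mem' := by
    intro c x hx
    refine (Summable.mul_left (c ^ 2) hx).congr fun n => ?_
    simp only [Pi.smul_apply, smul_eq_mul]
    ring

/-- The weighted space `l²_ρ`. It is a type of its own, so that it carries the topology of its
inner product `∑ xₙ yₙ ρₙ²` and not the topology of pointwise convergence. -/
def WeightedL2 (ρ : PosWeight) : Type := weightedL2Submodule ρ.1

namespace WeightedL2

variable {ρ : PosWeight}

instance : AddCommGroup (WeightedL2 ρ) := inferInstanceAs (AddCommGroup (weightedL2Submodule ρ.1))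

instance : Module ℝ (WeightedL2 ρ) := inferInstanceAs (Module ℝ (weightedL2Submodule ρ.1))

/-- The `n`-th coordinate of an element of `l²_ρ`. -/
def coord (x : WeightedL2 ρ) (n : ℕ) : ℝ := x.1 n

theorem summable_coord (x : WeightedL2 ρ) : Summable fun n => x.coord n ^ 2 * ρ.1 n ^ 2 := x.2

theorem coord_add (x y : WeightedL2 ρ) (n : ℕ) : (x + y).coord n = x.coord n + y.coord n := rfl

theorem coord_smul (c : ℝ) (x : WeightedL2 ρ) (n : ℕ) : (c • x).coord n = c * x.coord n := rfl

theorem coord_ext {x y : WeightedL2 ρ} (h : ∀ n, x.coord n = y.coord n) : x = y :=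
  Subtype.ext (funext h)

@[reducible]
def innerCore (ρ : PosWeight) : InnerProductSpace.Core ℝ (WeightedL2 ρ) where
  inner x y := ∑' n, x.coord n * y.coord n * ρ.1 n ^ 2
  conj_inner_symm x y := by
    simp only [conj_trivial]
    exact tsum_congr fun n => by ring
  re_inner_nonneg x := by
    simp only [RCLike.re_to_real]
    exact tsum_nonneg fun n => mul_nonneg (mul_self_nonneg _) (sq_nonneg _)
  add_left x y z := by
    rw [← (summable_weighted_mul x.summable_coord z.summable_coord).tsum_add
      (summable_weighted_mul y.summable_coord z.summable_coord)]
    exact tsum_congr fun n => by rw [coord_add]; ring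
  smul_left x y r := by
    simp only [conj_trivial]
    rw [← tsum_mul_left]
    exact tsum_congr fun n => by rw [coord_smul]; ring
  definite x hx := by
    have hs := summable_weighted_mul x.summable_coord x.summable_coord
    have h0 := congrFun ((hasSum_zero_iff_of_nonneg fun n =>
      mul_nonneg (mul_self_nonneg _) (sq_nonneg _)).1 (hx ▸ hs.hasSum))
    refine coord_ext fun n => ?_
    have h1 : x.coord n * x.coord n * ρ.1 n ^ 2 = 0 := h0 n
    have h2 : ρ.1 n ≠ 0 := (ρ.2 n).ne'
    have h3 : x.coord n = 0 := by simpa [h2] using h1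
    exact h3

instance : NormedAddCommGroup (WeightedL2 ρ) :=
  @InnerProductSpace.Core.toNormedAddCommGroup ℝ (WeightedL2 ρ) _ _ _ (innerCore ρ)

instance : InnerProductSpace ℝ (WeightedL2 ρ) :=
  InnerProductSpace.ofCore (innerCore ρ).toCore

/-- The Borel `σ`-algebra of `l²_ρ`. -/
instance : MeasurableSpace (WeightedL2 ρ) := borel (WeightedL2 ρ)

instance : BorelSpace (WeightedL2 ρ) := ⟨rfl⟩

end WeightedL2

end

/-!
Both directions of the equivalence compare truncated second moments. Write
`T m b = ∫ min ((b y)², 1) m(dy)` (`truncMoment`); the third condition says that `∑ₙ T ν βₙ < ∞`.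
By symmetry and the absence of a Gaussian part, the law `μₜ` of `Zₜ` has characteristic function
`exp (-t ψ(h))` with `ψ(h) = ∫ (1 - cos (h y)) ν(dy)` (`HasLevyTriplet.cosDefect_map`), so that
`∫ (1 - cos (h x)) μₜ(dx) = 1 - exp (-t ψ(h))`. For every s-finite `m`, the average over
`0 < h ≤ b` of `∫ (1 - cos (h y)) m(dy)` is comparable to `T m b`, because
`1 - sin x / x` is comparable to `min (x², 1)`. Applied to `m = μₜ` and to `m = ν`, this shows
that `T μₜ b` and `T ν b` are comparable as long as they are small
(`HasLevyTriplet.truncMoment_map_le`, `HasLevyTriplet.truncMoment_le_map`). Hence the third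
condition is equivalent to `∑ₙ E min ((βₙ Zⁿₜ)², 1) < ∞`, for one `t > 0` or for all `t`. This is
sufficient for almost sure convergence of `∑ₙ (βₙ Zⁿₜ)²`, and necessary by independence
(`tsum_lintegral_min_one_lt_top_of_iIndepFun`).

For the process in `l²_ρ`, Lévy's maximal inequality for symmetric increments
(`measure_exists_lt_abs_sum_le`) gives `E sup_{s ≤ t} min ((b Zₛ)², 1) ≤ 2 E min ((b Zₜ)², 1)`
(`IsLevyProcess.lintegral_truncSup_le`). So with `γₙ = ρₙ βₙ` the truncated squares of `γₙ Zⁿₛ`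
are almost surely dominated, uniformly in `s ≤ t`, by a summable sequence. By dominated convergence
in `l²_ρ`, càdlàg coordinates then yield a càdlàg path (`WeightedL2.isCadlagPath_ofSeq`). Measurability
comes from a measurable map `WeightedL2.ofSeq` from all sequences to `l²_ρ`, and the law and
independence of the increments are transported along this map from those of the sequence of
coordinates, the array of increments being independent in both indices (`iIndepFun_transpose`).
Suitable weights exist because `T ν b → 0` as `b → 0`.
-/

/-! ### Truncated second moments and averages of `1 - cos` -/

/-- The truncated second moment `∫ min ((b y)², 1) m(dy)`. -/
noncomputable def truncMoment (m : Measure ℝ) (b : ℝ) : ℝ≥0∞ :=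
  ∫⁻ y, ENNReal.ofReal (min ((b * y) ^ 2) 1) ∂m

/-- The integral `∫ (1 - cos (h y)) m(dy)`. For a symmetric probability measure it is one minus
the characteristic function; for a Lévy measure it is the real part of the Lévy-Khintchine exponent
without Gaussian part. -/
noncomputable def cosDefect (m : Measure ℝ) (h : ℝ) : ℝ≥0∞ :=
  ∫⁻ y, ENNReal.ofReal (1 - Real.cos (h * y)) ∂m

theorem truncatedMomentSum_eq_tsum_truncMoment (ν : Measure ℝ) {β : ℕ → ℝ} (hβ : ∀ n, 0 < β n) :
    truncatedMomentSum ν β = ∑' n, truncMoment ν (β n) := by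
  refine tsum_congr fun n => ?_
  have hA : MeasurableSet {y : ℝ | |y| < 1 / β n} :=
    measurableSet_lt measurable_norm measurable_const
  have hc : {y : ℝ | |y| < 1 / β n}ᶜ = {y : ℝ | 1 / β n ≤ |y|} := by
    ext y; simp
  rw [truncMoment, ← lintegral_add_compl (fun y => ENNReal.ofReal (min ((β n * y) ^ 2) 1)) hA]
  have key : ∀ y : ℝ, |y| < 1 / β n ↔ |β n * y| < 1 := fun y => by
    rw [lt_div_iff₀ (hβ n), abs_mul, abs_of_pos (hβ n), mul_comm]
  congr 1
  · rw [← lintegral_const_mul _ (by fun_prop)]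
    refine setLIntegral_congr_fun hA fun y hy => ?_
    have h1 : (β n * y) ^ 2 ≤ 1 := (sq_le_one_iff_abs_le_one _).2 ((key y).1 hy).le
    rw [min_eq_left h1, mul_pow, ENNReal.ofReal_mul (sq_nonneg _)]
  · rw [← hc, ← setLIntegral_one]
    refine setLIntegral_congr_fun hA.compl fun y hy => ?_
    have h0 : 1 ≤ |β n * y| := not_lt.1 fun h => hy ((key y).2 h)
    have h1 : 1 ≤ (β n * y) ^ 2 := (one_le_sq_iff_one_le_abs _).2 h0
    rw [min_eq_right h1, ENNReal.ofReal_one]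

theorem min_mul_sq_one_le (b y : ℝ) :
    min ((b * y) ^ 2) 1 ≤ max (b ^ 2) 1 * min (y ^ 2) 1 := by
  have h1 : b ^ 2 ≤ max (b ^ 2) 1 := le_max_left _ _
  have h2 : 1 ≤ max (b ^ 2) 1 := le_max_right _ _
  rcases le_total (y ^ 2) 1 with h | h
  · rw [min_eq_left h, mul_pow]
    exact (min_le_left _ _).trans (mul_le_mul_of_nonneg_right h1 (sq_nonneg _))
  · rw [min_eq_right h, mul_one]
    exact (min_le_right _ _).trans h2

theorem IsLevyMeasure.truncMoment_lt_top {ν : Measure ℝ} (hν : IsLevyMeasure ν) (b : ℝ) :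
    truncMoment ν b < ⊤ := by
  calc truncMoment ν b
      ≤ ∫⁻ y, ENNReal.ofReal (max (b ^ 2) 1) * ENNReal.ofReal (min (y ^ 2) 1) ∂ν := by
        refine lintegral_mono fun y => ?_
        rw [← ENNReal.ofReal_mul (by positivity)]
        exact ENNReal.ofReal_le_ofReal (min_mul_sq_one_le b y)
    _ < ⊤ := by
        rw [lintegral_const_mul _ (by fun_prop)]
        exact ENNReal.mul_lt_top ENNReal.ofReal_lt_top hν.lintegral_lt_top

/-- A Lévy measure `ν` is s-finite, as Tonelli's theorem requires: off the null set `{0}` it has a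
density with respect to the finite measure `min (y², 1) ν(dy)`. -/
theorem IsLevyMeasure.sFinite {ν : Measure ℝ} (hν : IsLevyMeasure ν) : SFinite ν := by
  have hm : Measurable fun y : ℝ => ENNReal.ofReal (min (y ^ 2) 1) := by fun_prop
  have := isFiniteMeasure_withDensity hν.lintegral_lt_top.ne
  rw [← withDensity_inv_same₀ hm.aemeasurable (μ := ν) _ (ae_of_all _ fun _ => ENNReal.ofReal_ne_top)]
  · infer_instance
  · have h0 : ∀ᵐ y ∂ν, y ≠ 0 := by
      rw [ae_iff]; simpa using hν.zero_singleton
    filter_upwards [h0] with y hy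
    have : 0 < min (y ^ 2) 1 := lt_min (by positivity) one_pos
    exact (ENNReal.ofReal_pos.2 this).ne'

/-- As the scale tends to zero, so does the truncated second moment of a Lévy measure. -/
theorem IsLevyMeasure.tendsto_truncMoment {ν : Measure ℝ} (hν : IsLevyMeasure ν) :
    Tendsto (fun k : ℕ => truncMoment ν (1 / ((k : ℝ) + 1))) atTop (𝓝 0) := by
  have h := tendsto_lintegral_of_dominated_convergence (μ := ν)
    (F := fun (k : ℕ) y => ENNReal.ofReal (min ((1 / ((k : ℝ) + 1) * y) ^ 2) 1)) (f := fun _ => 0)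
    (fun y => ENNReal.ofReal (min (y ^ 2) 1)) (fun k => by fun_prop)
    (fun k => ae_of_all _ fun y => ?_) hν.lintegral_lt_top.ne (ae_of_all _ fun y => ?_)
  · simpa [truncMoment] using h
  · refine ENNReal.ofReal_le_ofReal (min_le_min_right _ ?_)
    rw [mul_pow]
    refine mul_le_of_le_one_left (sq_nonneg _) (pow_le_one₀ (by positivity) ?_)
    rw [div_le_one (by positivity)]
    linarith [(Nat.cast_nonneg k : (0 : ℝ) ≤ k)]
  · have h1 : Tendsto (fun k : ℕ => min ((1 / ((k : ℝ) + 1) * y) ^ 2) 1) atTop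
        (𝓝 (min ((0 * y) ^ 2) 1)) :=
      (((tendsto_one_div_add_atTop_nhds_zero_nat (𝕜 := ℝ)).mul_const y).pow 2).min tendsto_const_nhds
    simpa using ENNReal.tendsto_ofReal h1

theorem one_sub_cos_le {b h y : ℝ} (h0 : 0 ≤ h) (hb : h ≤ b) :
    1 - Real.cos (h * y) ≤ 2 * min ((b * y) ^ 2) 1 := by
  have h1 := Real.one_sub_sq_div_two_le_cos (x := h * y)
  have h2 := Real.neg_one_le_cos (h * y)
  have h3 : (h * y) ^ 2 ≤ (b * y) ^ 2 := by
    rw [mul_pow, mul_pow]; gcongr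
  rcases le_total ((b * y) ^ 2) 1 with hle | hle
  · rw [min_eq_left hle]; nlinarith [sq_nonneg (h * y)]
  · rw [min_eq_right hle]; linarith

theorem cosDefect_le (m : Measure ℝ) {b h : ℝ} (h0 : 0 ≤ h) (hb : h ≤ b) :
    cosDefect m h ≤ 2 * truncMoment m b := by
  rw [truncMoment, ← lintegral_const_mul _ (by fun_prop)]
  refine lintegral_mono fun y => ?_
  rw [← ENNReal.ofReal_ofNat, ← ENNReal.ofReal_mul (by norm_num)]
  exact ENNReal.ofReal_le_ofReal (one_sub_cos_le h0 hb)

theorem sinc_le_of_abs_le_one {x : ℝ} (hx : |x| ≤ 1) : Real.sinc x ≤ 1 - x ^ 2 / 10 := by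
  wlog h : 0 ≤ x generalizing x
  · have := this (x := -x) (by rwa [abs_neg]) (by linarith)
    simpa using this
  rcases h.eq_or_lt with rfl | h
  · simp
  rw [Real.sinc_of_ne_zero h.ne', div_le_iff₀ h]
  have h1 := (abs_le.1 (Real.sin_bound hx)).2
  rw [abs_of_pos h] at h1 hx
  have : x ^ 4 ≤ x ^ 3 := by
    calc x ^ 4 = x ^ 3 * x := by ring
      _ ≤ x ^ 3 * 1 := by gcongr
      _ = x ^ 3 := mul_one _
  nlinarith [pow_pos h 3]

/-- The lower bound for `1 - sin x / x`. It follows from the Taylor expansion when `|x| ≤ 1`, extends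
to `|x| ≤ 2` by the duplication formula `sinc x = sinc (x / 2) cos (x / 2)`, and holds for `|x| ≥ 2`
because then `|sinc x| ≤ 1 / 2`. -/
theorem min_sq_one_le_one_sub_sinc (x : ℝ) : min (x ^ 2) 1 ≤ 40 * (1 - Real.sinc x) := by
  rcases le_total |x| 2 with h | h
  · have h1 : Real.sinc x ≤ Real.sinc (x / 2) := by
      rcases eq_or_ne x 0 with rfl | hx
      · simp
      have hs : Real.sinc x = Real.sinc (x / 2) * Real.cos (x / 2) := by
        rw [Real.sinc_of_ne_zero hx, Real.sinc_of_ne_zero (by simpa using hx)]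
        conv_lhs => rw [show x = 2 * (x / 2) by ring, Real.sin_two_mul]
        field_simp
      have h0 : 0 ≤ Real.sinc (x / 2) := by
        have habs : |x / 2| ≤ 1 := by rw [abs_div]; norm_num; linarith
        rcases lt_or_gt_of_ne hx with hn | hp
        · rw [← Real.sinc_neg, Real.sinc_of_ne_zero (by simpa using hx)]
          refine div_nonneg (Real.sin_nonneg_of_nonneg_of_le_pi (by linarith) ?_) (by linarith)
          linarith [(abs_le.1 habs).1, Real.pi_gt_three]
        · rw [Real.sinc_of_ne_zero (by simpa using hx)]
          refine div_nonneg (Real.sin_nonneg_of_nonneg_of_le_pi (by linarith) ?_) (by linarith)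
          linarith [(abs_le.1 habs).2, Real.pi_gt_three]
      rw [hs]
      exact mul_le_of_le_one_right h0 (Real.cos_le_one _)
    have h2 := sinc_le_of_abs_le_one (x := x / 2) (by rw [abs_div]; norm_num; linarith)
    refine (min_le_left _ _).trans ?_
    nlinarith
  · have hx : x ≠ 0 := by rintro rfl; norm_num at h
    have h1 := Real.sinc_le_inv_abs hx
    have h2 : |x|⁻¹ ≤ 2⁻¹ := inv_anti₀ (by norm_num) h
    refine (min_le_right _ _).trans ?_
    norm_num at h2 ⊢
    linarith

theorem integral_one_sub_cos_mul (b y : ℝ) :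
    ∫ h in (0 : ℝ)..b, (1 - Real.cos (h * y)) = b * (1 - Real.sinc (b * y)) := by
  rw [intervalIntegral.integral_sub (by simp)
    ((by fun_prop : Continuous fun h : ℝ => Real.cos (h * y)).intervalIntegrable _ _)]
  rcases eq_or_ne y 0 with rfl | hy
  · simp
  rcases eq_or_ne b 0 with rfl | hb
  · simp
  rw [intervalIntegral.integral_comp_mul_right (fun x => Real.cos x) hy,
    Real.sinc_of_ne_zero (mul_ne_zero hb hy)]
  simp
  field_simp

/-- Averaging `1 - cos (h y)` over `0 < h ≤ b` recovers `min ((b y)², 1)` up to a constant. -/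
theorem truncMoment_le_lintegral_cosDefect (m : Measure ℝ) [SFinite m] {b : ℝ} (hb : 0 < b) :
    ENNReal.ofReal b * truncMoment m b ≤ 40 * ∫⁻ h in Set.Ioc 0 b, cosDefect m h := by
  unfold cosDefect
  rw [lintegral_lintegral_swap (by fun_prop), truncMoment, ← lintegral_const_mul _ (by fun_prop),
    ← lintegral_const_mul _ (by fun_prop)]
  refine lintegral_mono fun y => ?_
  rw [← ofReal_integral_eq_lintegral_ofReal, ← intervalIntegral.integral_of_le hb.le,
    integral_one_sub_cos_mul, ← ENNReal.ofReal_mul hb.le, ← ENNReal.ofReal_ofNat,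
    ← ENNReal.ofReal_mul (by norm_num)]
  · refine ENNReal.ofReal_le_ofReal ?_
    nlinarith [min_sq_one_le_one_sub_sinc (b * y)]
  · exact ((by fun_prop : Continuous fun h : ℝ => 1 - Real.cos (h * y)).integrableOn_Icc).mono_set
      Set.Ioc_subset_Icc_self
  · exact ae_of_all _ fun h => sub_nonneg.2 (Real.cos_le_one _)

/-! ### Characteristic functions of symmetric processes without Gaussian part -/

/-- The integrand of the Lévy-Khintchine exponent is dominated by a multiple of `min (y², 1)`; in
particular the integral defining the exponent is a genuine one. -/
theorem norm_exp_mul_I_sub_compensator_le (h y : ℝ) :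
    ‖Complex.exp (Complex.I * (h : ℂ) * (y : ℂ)) - 1
        - Complex.I * (h : ℂ) * (y : ℂ) / (1 + (y : ℂ) ^ 2)‖
      ≤ (h ^ 2 * Real.exp |h| + |h| + 2) * min (y ^ 2) 1 := by
  have hcomp : ‖Complex.I * (h : ℂ) * (y : ℂ) / (1 + (y : ℂ) ^ 2)‖ = |h| * |y| / (1 + y ^ 2) := by
    have : (1 + (y : ℂ) ^ 2) = ((1 + y ^ 2 : ℝ) : ℂ) := by push_cast; rfl
    rw [this, norm_div, norm_mul, norm_mul, Complex.norm_I, Complex.norm_real, Complex.norm_real,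
      Complex.norm_real, Real.norm_eq_abs, Real.norm_eq_abs, Real.norm_eq_abs, one_mul,
      abs_of_pos (show (0 : ℝ) < 1 + y ^ 2 by positivity)]
  have hE : 0 ≤ h ^ 2 * Real.exp |h| := by positivity
  have hh := abs_nonneg h
  have hy := abs_nonneg y
  rcases le_total |y| 1 with hle | hle
  · have hsq : y ^ 2 ≤ 1 := (sq_le_one_iff_abs_le_one _).2 hle
    rw [min_eq_left hsq]
    have h1 := Complex.norm_exp_sub_sum_le_norm_mul_exp (Complex.I * (h : ℂ) * (y : ℂ)) 2
    have hn : ‖Complex.I * (h : ℂ) * (y : ℂ)‖ = |h| * |y| := by simp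
    rw [hn] at h1
    simp only [Finset.sum_range_succ, Finset.sum_range_zero, pow_zero, pow_one, Nat.factorial,
      Nat.cast_one, div_one, zero_add, mul_one] at h1
    have h2 : (|h| * |y|) ^ 2 * Real.exp (|h| * |y|) ≤ h ^ 2 * Real.exp |h| * y ^ 2 := by
      rw [mul_pow, sq_abs, sq_abs]
      have : Real.exp (|h| * |y|) ≤ Real.exp |h| :=
        Real.exp_le_exp.2 (mul_le_of_le_one_right hh hle)
      calc h ^ 2 * y ^ 2 * Real.exp (|h| * |y|) ≤ h ^ 2 * y ^ 2 * Real.exp |h| := by gcongr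
        _ = _ := by ring
    have hne : (1 + (y : ℂ) ^ 2) ≠ 0 := by
      have : (1 + (y : ℂ) ^ 2) = ((1 + y ^ 2 : ℝ) : ℂ) := by push_cast; rfl
      rw [this, Complex.ofReal_ne_zero]; positivity
    have hsplit : Complex.exp (Complex.I * (h : ℂ) * (y : ℂ)) - 1
        - Complex.I * (h : ℂ) * (y : ℂ) / (1 + (y : ℂ) ^ 2)
        = (Complex.exp (Complex.I * (h : ℂ) * (y : ℂ)) - (1 + Complex.I * (h : ℂ) * (y : ℂ)))
          + (y : ℂ) ^ 2 * (Complex.I * (h : ℂ) * (y : ℂ) / (1 + (y : ℂ) ^ 2)) := by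
      field_simp; ring
    rw [hsplit]
    refine (norm_add_le _ _).trans ?_
    rw [norm_mul, hcomp, norm_pow, Complex.norm_real, Real.norm_eq_abs, sq_abs]
    have h3 : |h| * |y| / (1 + y ^ 2) ≤ |h| := by
      rw [div_le_iff₀ (by positivity)]
      nlinarith [sq_nonneg y, mul_nonneg hh (sq_nonneg y)]
    have h4 : y ^ 2 * (|h| * |y| / (1 + y ^ 2)) ≤ y ^ 2 * |h| := by gcongr
    have h5 := h1.trans h2
    nlinarith [sq_nonneg y]
  · have hsq : 1 ≤ y ^ 2 := (one_le_sq_iff_one_le_abs _).2 hle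
    rw [min_eq_right hsq, mul_one]
    have h1 : ‖Complex.exp (Complex.I * (h : ℂ) * (y : ℂ))‖ = 1 := by
      rw [show Complex.I * (h : ℂ) * (y : ℂ) = ((h * y : ℝ) : ℂ) * Complex.I by push_cast; ring]
      exact Complex.norm_exp_ofReal_mul_I _
    have h3 : |h| * |y| / (1 + y ^ 2) ≤ |h| := by
      rw [div_le_iff₀ (by positivity)]
      have : |y| ≤ 1 + y ^ 2 := by rw [← sq_abs]; nlinarith
      exact mul_le_mul_of_nonneg_left this hh
    calc _ ≤ ‖Complex.exp (Complex.I * (h : ℂ) * (y : ℂ))‖ + ‖(1 : ℂ)‖ + |h| * |y| / (1 + y ^ 2) := by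
          rw [← hcomp]
          exact (norm_sub_le _ _).trans (add_le_add_left (norm_sub_le _ _) _)
      _ ≤ _ := by rw [h1, norm_one]; linarith

theorem IsLevyMeasure.integrable_min_sq_one {ν : Measure ℝ} (hν : IsLevyMeasure ν) :
    Integrable (fun y : ℝ => min (y ^ 2) 1) ν := by
  refine ⟨by fun_prop, ?_⟩
  rw [hasFiniteIntegral_iff_ofReal (ae_of_all _ fun y => by positivity)]
  exact hν.lintegral_lt_top

theorem IsLevyMeasure.integrable_exp_sub_compensator {ν : Measure ℝ} (hν : IsLevyMeasure ν)
    (h : ℝ) : Integrable (fun y : ℝ => Complex.exp (Complex.I * (h : ℂ) * (y : ℂ)) - 1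
        - Complex.I * (h : ℂ) * (y : ℂ) / (1 + (y : ℂ) ^ 2)) ν :=
  (hν.integrable_min_sq_one.const_mul _).mono' (by fun_prop)
    (ae_of_all _ fun y => norm_exp_mul_I_sub_compensator_le h y)

theorem re_levyKhintchineExponent {ν : Measure ℝ} (hν : IsLevyMeasure ν) (a h : ℝ) :
    (levyKhintchineExponent 0 a ν h).re = (cosDefect ν h).toReal := by
  have hre : ∀ y : ℝ, (Complex.exp (Complex.I * (h : ℂ) * (y : ℂ)) - 1
        - Complex.I * (h : ℂ) * (y : ℂ) / (1 + (y : ℂ) ^ 2)).re = -(1 - Real.cos (h * y)) := by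
    intro y
    have h1 : Complex.I * (h : ℂ) * (y : ℂ) = ((h * y : ℝ) : ℂ) * Complex.I := by push_cast; ring
    have h2 : Complex.I * (h : ℂ) * (y : ℂ) / (1 + (y : ℂ) ^ 2)
        = ((h * y / (1 + y ^ 2) : ℝ) : ℂ) * Complex.I := by rw [h1]; push_cast; ring
    rw [h2, h1]
    simp [Complex.exp_ofReal_mul_I_re, -Complex.ofReal_mul, -Complex.ofReal_div]
  have h1 := integral_re (𝕜 := ℂ) (hν.integrable_exp_sub_compensator h)
  simp only [RCLike.re_eq_complex_re, hre, integral_neg] at h1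
  rw [integral_eq_lintegral_of_nonneg_ae
    (ae_of_all _ fun y => sub_nonneg.2 (Real.cos_le_one _)) (by fun_prop)] at h1
  rw [levyKhintchineExponent, Complex.sub_re, ← h1]
  simp [cosDefect]

theorem cosDefect_eq_ofReal_one_sub_re_charFun (μ : Measure ℝ) [IsProbabilityMeasure μ] (h : ℝ) :
    cosDefect μ h = ENNReal.ofReal (1 - (charFun μ h).re) := by
  have hint : Integrable (fun x : ℝ => Real.cos (h * x)) μ :=
    (integrable_const (1 : ℝ)).mono' (by fun_prop) (ae_of_all _ fun x => Real.abs_cos_le_one _)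
  have hre : (charFun μ h).re = ∫ x, Real.cos (h * x) ∂μ := by
    rw [charFun_apply_real]
    have := integral_re (𝕜 := ℂ) (μ := μ) (f := fun x : ℝ => Complex.exp (h * x * Complex.I))
      ((integrable_const (1 : ℝ)).mono' (by fun_prop) (ae_of_all _ fun x => by
        rw [← Complex.ofReal_mul, Complex.norm_exp_ofReal_mul_I]))
    simp only [RCLike.re_eq_complex_re] at this
    rw [← this]
    refine integral_congr_ae (ae_of_all _ fun x => ?_)
    simp only
    rw [← Complex.ofReal_mul, Complex.exp_ofReal_mul_I_re]
  have hsub : Integrable (fun x : ℝ => 1 - Real.cos (h * x)) μ := (integrable_const _).sub hint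
  rw [cosDefect, ← ofReal_integral_eq_lintegral_ofReal hsub
    (ae_of_all _ fun x => sub_nonneg.2 (Real.cos_le_one _)), integral_sub (integrable_const _) hint,
    hre]
  simp

theorem im_charFun_eq_zero_of_identDistrib_neg {Ω : Type*} [MeasurableSpace Ω] {P : Measure Ω}
    {X : Ω → ℝ} (hX : IdentDistrib X (fun ω => -X ω) P P) (h : ℝ) :
    (charFun (P.map X) h).im = 0 := by
  have h1 : P.map X = (P.map X).map (fun x => -1 * x) := by
    rw [AEMeasurable.map_map_of_aemeasurable (by fun_prop) hX.aemeasurable_fst]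
    convert hX.map_eq using 2
    ext ω; simp
  have h2 : charFun (P.map X) h = (starRingEnd ℂ) (charFun (P.map X) h) := by
    conv_lhs => rw [h1, charFun_map_mul, neg_one_mul, charFun_neg]
  exact Complex.conj_eq_iff_im.1 h2.symm

/-- The characteristic function of a symmetric process with triplet `(0, a, ν)` is
`exp (-t ∫ (1 - cos (h y)) ν(dy))`. The law at time `t / 2` has a real characteristic function,
whose square is the one at time `t`; hence the latter equals its own modulus. -/
theorem HasLevyTriplet.cosDefect_map {Ω : Type*} [MeasurableSpace Ω] {P : Measure Ω}
    [IsProbabilityMeasure P] {X : ℝ≥0 → Ω → ℝ} {a : ℝ} {ν : Measure ℝ}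
    (htr : HasLevyTriplet X P 0 a ν) (hX : ∀ t, AEMeasurable (X t) P)
    (hsymm : ∀ t, IdentDistrib (X t) (fun ω => -X t ω) P P)
    (t : ℝ≥0) (h : ℝ) :
    cosDefect (P.map (X t)) h
      = ENNReal.ofReal (1 - Real.exp (-((t : ℝ) * (cosDefect ν h).toReal))) := by
  have := Measure.isProbabilityMeasure_map (μ := P) (hX t)
  rw [cosDefect_eq_ofReal_one_sub_re_charFun]
  have hsq : charFun (P.map (X t)) h = charFun (P.map (X (t / 2))) h ^ 2 := by
    rw [htr.charFun_eq, htr.charFun_eq, ← Complex.exp_nat_mul]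
    congr 1
    push_cast
    ring
  have him := im_charFun_eq_zero_of_identDistrib_neg (hsymm (t / 2)) h
  have hnn : (charFun (P.map (X t)) h).re = ‖charFun (P.map (X t)) h‖ := by
    obtain ⟨r, hr⟩ : ∃ r : ℝ, charFun (P.map (X (t / 2))) h = r :=
      ⟨_, (Complex.ext rfl (by simpa using him))⟩
    rw [hsq, hr, ← Complex.ofReal_pow, Complex.ofReal_re, Complex.norm_real,
      Real.norm_of_nonneg (sq_nonneg r)]
  rw [hnn, htr.charFun_eq, Complex.norm_exp, ← re_levyKhintchineExponent htr.levyMeasure a h]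
  simp

/-! ### Comparison of the marginal laws with the Lévy measure -/

section Comparison

variable {Ω : Type*} [MeasurableSpace Ω] {P : Measure Ω} [IsProbabilityMeasure P]
  {X : ℝ≥0 → Ω → ℝ} {a : ℝ} {ν : Measure ℝ}

theorem IsLevyMeasure.cosDefect_lt_top {ν : Measure ℝ} (hν : IsLevyMeasure ν) {h : ℝ}
    (h0 : 0 ≤ h) : cosDefect ν h < ⊤ :=
  (cosDefect_le ν h0 le_rfl).trans_lt
    (ENNReal.mul_lt_top ENNReal.ofNat_lt_top (hν.truncMoment_lt_top h))

/-- At scale `b`, the law at time `t` has truncated second moment at most `80 t` times that of the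
Lévy measure. -/
theorem HasLevyTriplet.truncMoment_map_le (htr : HasLevyTriplet X P 0 a ν)
    (hX : ∀ t, AEMeasurable (X t) P)
    (hsymm : ∀ t, IdentDistrib (X t) (fun ω => -X t ω) P P) (t : ℝ≥0) {b : ℝ} (hb : 0 < b) :
    truncMoment (P.map (X t)) b ≤ 80 * t * truncMoment ν b := by
  have := Measure.isProbabilityMeasure_map (μ := P) (hX t)
  have hle : ∀ h ∈ Set.Ioc 0 b, cosDefect (P.map (X t)) h ≤ t * (2 * truncMoment ν b) := by
    intro h hh
    rw [htr.cosDefect_map hX hsymm]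
    calc ENNReal.ofReal (1 - Real.exp (-((t : ℝ) * (cosDefect ν h).toReal)))
        ≤ ENNReal.ofReal (t * (cosDefect ν h).toReal) :=
          ENNReal.ofReal_le_ofReal (by
            linarith [Real.add_one_le_exp (-((t : ℝ) * (cosDefect ν h).toReal))])
      _ = t * cosDefect ν h := by
          rw [ENNReal.ofReal_mul t.coe_nonneg, ENNReal.ofReal_coe_nnreal,
            ENNReal.ofReal_toReal (htr.levyMeasure.cosDefect_lt_top hh.1.le).ne]
      _ ≤ t * (2 * truncMoment ν b) := by gcongr; exact cosDefect_le ν hh.1.le hh.2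
  have h1 := truncMoment_le_lintegral_cosDefect (P.map (X t)) hb
  have h2 := setLIntegral_mono (μ := volume) (measurable_const) hle
  rw [setLIntegral_const, Real.volume_Ioc, sub_zero] at h2
  have hb0 : ENNReal.ofReal b ≠ 0 := (ENNReal.ofReal_pos.2 hb).ne'
  rw [← ENNReal.mul_le_mul_iff_right hb0 ENNReal.ofReal_ne_top]
  calc ENNReal.ofReal b * truncMoment (P.map (X t)) b
      ≤ 40 * (t * (2 * truncMoment ν b) * ENNReal.ofReal b) := h1.trans (by gcongr)
    _ = ENNReal.ofReal b * (80 * t * truncMoment ν b) := by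
      rw [show (80 : ℝ≥0∞) = 40 * 2 by norm_num]; ring

/-- The converse comparison. The exponent is bounded by twice the truncated moment `T` of `ν` on
`[0, b]`, and `1 - exp (-x) ≥ x / (1 + x)`, so the exponent is controlled by one minus the
characteristic function up to the factor `1 + 2 t T`. -/
theorem HasLevyTriplet.truncMoment_le_map (htr : HasLevyTriplet X P 0 a ν)
    (hX : ∀ t, AEMeasurable (X t) P)
    (hsymm : ∀ t, IdentDistrib (X t) (fun ω => -X t ω) P P) (t : ℝ≥0) {b : ℝ} (hb : 0 < b) :
    t * truncMoment ν b
      ≤ 80 * (1 + 2 * t * truncMoment ν b) * truncMoment (P.map (X t)) b := by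
  have := Measure.isProbabilityMeasure_map (μ := P) (hX t)
  have := htr.levyMeasure.sFinite
  have hle : ∀ h ∈ Set.Ioc 0 b, t * cosDefect ν h
      ≤ (1 + 2 * t * truncMoment ν b) * (2 * truncMoment (P.map (X t)) b) := by
    intro h hh
    have hψ := (htr.levyMeasure.cosDefect_lt_top hh.1.le).ne
    have hψT := cosDefect_le ν hh.1.le hh.2
    have h1 := cosDefect_le (P.map (X t)) hh.1.le hh.2
    refine le_trans ?_ (mul_le_mul_right h1 _)
    rw [htr.cosDefect_map hX hsymm]
    set ψ := cosDefect ν h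
    have hx : 0 ≤ (t : ℝ) * ψ.toReal := by positivity
    have hexp : (t : ℝ) * ψ.toReal
        ≤ (1 + t * ψ.toReal) * (1 - Real.exp (-((t : ℝ) * ψ.toReal))) := by
      have h2 := Real.add_one_le_exp ((t : ℝ) * ψ.toReal)
      have h3 : Real.exp ((t : ℝ) * ψ.toReal) * Real.exp (-((t : ℝ) * ψ.toReal)) = 1 := by
        rw [← Real.exp_add]; simp
      nlinarith [Real.exp_pos (-((t : ℝ) * ψ.toReal))]
    calc t * ψ = ENNReal.ofReal (t * ψ.toReal) := by
          rw [ENNReal.ofReal_mul t.coe_nonneg, ENNReal.ofReal_coe_nnreal, ENNReal.ofReal_toReal hψ]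
      _ ≤ ENNReal.ofReal ((1 + t * ψ.toReal) * (1 - Real.exp (-((t : ℝ) * ψ.toReal)))) :=
          ENNReal.ofReal_le_ofReal hexp
      _ = (1 + t * ψ) * ENNReal.ofReal (1 - Real.exp (-((t : ℝ) * ψ.toReal))) := by
          rw [ENNReal.ofReal_mul (by positivity), ENNReal.ofReal_add one_pos.le hx,
            ENNReal.ofReal_mul t.coe_nonneg, ENNReal.ofReal_coe_nnreal, ENNReal.ofReal_toReal hψ,
            ENNReal.ofReal_one]
      _ ≤ _ := by
          have : t * ψ ≤ 2 * t * truncMoment ν b :=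
            calc t * ψ ≤ t * (2 * truncMoment ν b) := by gcongr
              _ = 2 * t * truncMoment ν b := by ring
          exact mul_le_mul_left (add_le_add_right this 1) _
  have h1 := truncMoment_le_lintegral_cosDefect ν hb
  have h2 := setLIntegral_mono (μ := volume) (measurable_const) hle
  rw [setLIntegral_const, Real.volume_Ioc, sub_zero,
    lintegral_const_mul' _ _ ENNReal.coe_ne_top] at h2
  have hb0 : ENNReal.ofReal b ≠ 0 := (ENNReal.ofReal_pos.2 hb).ne'
  rw [← ENNReal.mul_le_mul_iff_right hb0 ENNReal.ofReal_ne_top]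
  calc ENNReal.ofReal b * (t * truncMoment ν b)
      = t * (ENNReal.ofReal b * truncMoment ν b) := by ring
    _ ≤ t * (40 * ∫⁻ h in Set.Ioc 0 b, cosDefect ν h) := by gcongr
    _ = 40 * (t * ∫⁻ h in Set.Ioc 0 b, cosDefect ν h) := by ring
    _ ≤ 40 * ((1 + 2 * t * truncMoment ν b) * (2 * truncMoment (P.map (X t)) b)
          * ENNReal.ofReal b) := by gcongr
    _ = _ := by rw [show (80 : ℝ≥0∞) = 40 * 2 by norm_num]; ring

end Comparison

/-- A series of terms `v n` with `t v n ≤ C (1 + 2 t v n) u n` converges along with `∑ u n`: once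
`2 C u n ≤ 1 / 2`, half of the left-hand side absorbs the factor `1 + 2 t v n`. -/
theorem tsum_lt_top_of_le_mul {u v : ℕ → ℝ≥0∞} {t : ℝ≥0} (ht : 0 < t) (C : ℝ≥0)
    (hv : ∀ n, v n < ⊤) (hu : ∑' n, u n < ⊤)
    (h : ∀ n, t * v n ≤ C * (1 + 2 * t * v n) * u n) : ∑' n, v n < ⊤ := by
  have hun : ∀ n, u n ≠ ⊤ := ENNReal.ne_top_of_tsum_ne_top hu.ne
  have hs := ENNReal.summable_toReal hu.ne
  have hreal : ∀ n, (t : ℝ) * (v n).toReal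
      ≤ C * (1 + 2 * t * (v n).toReal) * (u n).toReal := by
    intro n
    have hfin : (C : ℝ≥0∞) * (1 + 2 * t * v n) * u n ≠ ⊤ := by
      have := (hv n).ne
      have := hun n
      finiteness
    have := ENNReal.toReal_mono hfin (h n)
    rwa [ENNReal.toReal_mul, ENNReal.toReal_mul, ENNReal.toReal_mul,
      ENNReal.toReal_add ENNReal.one_ne_top (by have := (hv n).ne; finiteness),
      ENNReal.toReal_mul, ENNReal.toReal_mul, ENNReal.toReal_ofNat, ENNReal.toReal_one,
      ENNReal.coe_toReal, ENNReal.coe_toReal] at this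
  have htend : Tendsto (fun n => 2 * (C : ℝ) * (u n).toReal) atTop (𝓝 0) := by
    simpa using hs.tendsto_atTop_zero.const_mul (2 * (C : ℝ))
  have ht' : (0 : ℝ) < t := ht
  have hsum : Summable fun n => (v n).toReal := by
    refine Summable.of_norm_bounded_eventually_nat 
      (g := fun n => 2 * (C : ℝ) / t * (u n).toReal) (hs.mul_left _) ?_
    filter_upwards [htend.eventually_le_const (show (0 : ℝ) < 1 / 2 by norm_num)] with n hn
    rw [Real.norm_of_nonneg ENNReal.toReal_nonneg, div_mul_eq_mul_div, le_div_iff₀ ht']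
    have := mul_le_mul_of_nonneg_right hn
      (mul_nonneg ht'.le (ENNReal.toReal_nonneg (a := v n)))
    nlinarith [hreal n]
  have := hsum.tsum_ofReal_lt_top
  simpa only [ENNReal.ofReal_toReal (hv _).ne] using this

/-! ### Series of nonnegative random variables -/

section Series

variable {Ω : Type*} [MeasurableSpace Ω] {P : Measure Ω}

theorem ae_summable_of_tsum_lintegral_lt_top {M : ℕ → Ω → ℝ} (hM : ∀ n, AEMeasurable (M n) P)
    (h0 : ∀ n ω, 0 ≤ M n ω) (h : ∑' n, ∫⁻ ω, ENNReal.ofReal (M n ω) ∂P < ⊤) :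
    ∀ᵐ ω ∂P, Summable fun n => M n ω := by
  rw [← lintegral_tsum (fun n => (hM n).ennreal_ofReal)] at h
  filter_upwards [ae_lt_top' (AEMeasurable.tsum fun n => (hM n).ennreal_ofReal) h.ne]
    with ω hω
  simpa only [ENNReal.toReal_ofReal (h0 _ ω)] using ENNReal.summable_toReal hω.ne

theorem summable_of_summable_min_one {x : ℕ → ℝ} (h0 : ∀ n, 0 ≤ x n)
    (h : Summable fun n => min (x n) 1) : Summable x := by
  refine Summable.of_norm_bounded_eventually_nat h ?_
  filter_upwards [h.tendsto_atTop_zero.eventually_lt_const one_pos] with n hn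
  rw [Real.norm_of_nonneg (h0 n)]
  rcases min_lt_iff.1 hn with h1 | h1
  · rw [min_eq_left h1.le]
  · exact absurd h1 (lt_irrefl _)

theorem min_one_le_two_mul_one_sub_exp_neg {x : ℝ} (hx : 0 ≤ x) :
    min x 1 ≤ 2 * (1 - Real.exp (-x)) := by
  have h1 := Real.add_one_le_exp x
  have h2 : Real.exp x * Real.exp (-x) = 1 := by rw [← Real.exp_add]; simp
  have h3 := Real.exp_pos (-x)
  rcases le_total x 1 with h | h
  · rw [min_eq_left h]; nlinarith
  · rw [min_eq_right h]; nlinarith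

/-- An almost surely convergent series of independent nonnegative random variables has summable
truncated means: `E exp (-∑ Xₙ)` is positive and is at most `∏ E exp (-Xₙ)`, which in turn is
at most `exp (-∑ E (1 - exp (-Xₙ)))`. -/
theorem tsum_lintegral_min_one_lt_top_of_iIndepFun [IsProbabilityMeasure P] {X : ℕ → Ω → ℝ}
    (hX : ∀ n, Measurable (X n)) (h0 : ∀ n ω, 0 ≤ X n ω) (hind : iIndepFun X P)
    (h : ∀ᵐ ω ∂P, Summable fun n => X n ω) :
    ∑' n, ∫⁻ ω, ENNReal.ofReal (min (X n ω) 1) ∂P < ⊤ := by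
  have hexp : ∀ n, Integrable (fun ω => Real.exp (-X n ω)) P := fun n =>
    (integrable_const (1 : ℝ)).mono' ((hX n).neg.exp.aestronglyMeasurable)
      (ae_of_all _ fun ω => by
        rw [Real.norm_of_nonneg (Real.exp_pos _).le]
        exact Real.exp_le_one_iff.2 (neg_nonpos.2 (h0 n ω)))
  have hexpN : ∀ N : ℕ, Integrable (fun ω => Real.exp (-∑ n ∈ Finset.range N, X n ω)) P :=
    fun N => (integrable_const (1 : ℝ)).mono'
      ((Finset.measurable_sum _ fun n _ => hX n).neg.exp.aestronglyMeasurable)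
      (ae_of_all _ fun ω => by
        rw [Real.norm_of_nonneg (Real.exp_pos _).le]
        exact Real.exp_le_one_iff.2 (neg_nonpos.2 (Finset.sum_nonneg fun n _ => h0 n ω)))
  have hS : Integrable (fun ω => Real.exp (-∑' n, X n ω)) P := by
    refine (integrable_const (1 : ℝ)).mono' ?_ (ae_of_all _ fun ω => ?_)
    · refine aestronglyMeasurable_of_tendsto_ae atTop (fun N => (hexpN N).aestronglyMeasurable) ?_
      filter_upwards [h] with ω hω
      exact (Real.continuous_exp.tendsto _).comp hω.hasSum.tendsto_sum_nat.neg
    · rw [Real.norm_of_nonneg (Real.exp_pos _).le]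
      exact Real.exp_le_one_iff.2 (neg_nonpos.2 (tsum_nonneg fun n => h0 n ω))
  set δ := ∫ ω, Real.exp (-∑' n, X n ω) ∂P with hδ
  have hδ0 : 0 < δ := integral_exp_pos hS
  have hint : ∀ n, Integrable (fun ω => min (X n ω) 1) P := fun n =>
    (integrable_const (1 : ℝ)).mono' ((hX n).min measurable_const).aestronglyMeasurable
      (ae_of_all _ fun ω => by
        rw [Real.norm_of_nonneg (le_min (h0 n ω) one_pos.le)]; exact min_le_right _ _)
  have hnn : ∀ n, 0 ≤ ∫ ω, min (X n ω) 1 ∂P := fun n =>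
    integral_nonneg fun ω => le_min (h0 n ω) one_pos.le
  -- Each factor is at most `exp (-(1 - E exp (-Xₙ)))`, and `1 - exp (-x) ≥ min (x, 1) / 2`.
  have hstep : ∀ n, ∫ ω, Real.exp (-X n ω) ∂P ≤ Real.exp (-((∫ ω, min (X n ω) 1 ∂P) / 2)) := by
    intro n
    have h1 : ∫ ω, min (X n ω) 1 ∂P ≤ ∫ ω, 2 * (1 - Real.exp (-X n ω)) ∂P :=
      integral_mono (hint n) (((integrable_const _).sub (hexp n)).const_mul 2)
        fun ω => min_one_le_two_mul_one_sub_exp_neg (h0 n ω)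
    rw [integral_const_mul, integral_sub (integrable_const _) (hexp n)] at h1
    simp only [integral_const, probReal_univ, smul_eq_mul, mul_one] at h1
    refine le_trans ?_ (Real.add_one_le_exp _)
    linarith
  have hbound : ∀ N : ℕ, ∑ n ∈ Finset.range N, ∫ ω, min (X n ω) 1 ∂P ≤ 2 * -Real.log δ := by
    intro N
    have h1 : δ ≤ ∫ ω, Real.exp (-∑ n ∈ Finset.range N, X n ω) ∂P := by
      refine integral_mono_ae hS (hexpN N) ?_
      filter_upwards [h] with ω hω
      exact Real.exp_le_exp.2 (neg_le_neg (hω.sum_le_tsum _ fun n _ => h0 n ω))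
    have h2 : ∫ ω, Real.exp (-∑ n ∈ Finset.range N, X n ω) ∂P
        = ∏ n ∈ Finset.range N, ∫ ω, Real.exp (-X n ω) ∂P := by
      have := hind.mgf_sum (t := -1) hX (Finset.range N)
      simpa [mgf] using this
    have h3 : δ ≤ Real.exp (∑ n ∈ Finset.range N, -((∫ ω, min (X n ω) 1 ∂P) / 2)) := by
      rw [Real.exp_sum]
      refine (h1.trans h2.le).trans (Finset.prod_le_prod (fun n _ => ?_) fun n _ => hstep n)
      exact integral_nonneg fun ω => (Real.exp_pos _).le
    have h4 := (Real.log_le_iff_le_exp hδ0).2 h3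
    rw [Finset.sum_neg_distrib, ← Finset.sum_div] at h4
    linarith
  have hsum := summable_of_sum_range_le hnn hbound
  have := hsum.tsum_ofReal_lt_top
  simpa only [ofReal_integral_eq_lintegral_ofReal (hint _)
    (ae_of_all _ fun ω => le_min (h0 _ ω) one_pos.le)] using this

end Series

/-! ### Lévy's maximal inequality -/

/-- The sequence `v` with the sign of all terms from the `k`-th on reversed. -/
noncomputable def flipFrom (k : ℕ) (v : ℕ → ℝ) : ℕ → ℝ := fun i => if i < k then v i else -v i

theorem measurable_flipFrom (k : ℕ) : Measurable (flipFrom k) := by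
  refine measurable_pi_lambda _ fun i => ?_
  unfold flipFrom
  split_ifs <;> fun_prop

theorem sum_flipFrom_of_le {k j : ℕ} (h : j ≤ k) (v : ℕ → ℝ) :
    ∑ i ∈ Finset.range j, flipFrom k v i = ∑ i ∈ Finset.range j, v i :=
  Finset.sum_congr rfl fun _ hi => if_pos ((Finset.mem_range.1 hi).trans_le h)

theorem sum_flipFrom_of_ge {k N : ℕ} (h : k ≤ N) (v : ℕ → ℝ) :
    ∑ i ∈ Finset.range N, flipFrom k v i
      = 2 * ∑ i ∈ Finset.range k, v i - ∑ i ∈ Finset.range N, v i := by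
  rw [← Finset.sum_range_add_sum_Ico _ h, ← Finset.sum_range_add_sum_Ico v h,
    sum_flipFrom_of_le le_rfl]
  have : ∑ i ∈ Finset.Ico k N, flipFrom k v i = -∑ i ∈ Finset.Ico k N, v i := by
    rw [← Finset.sum_neg_distrib]
    exact Finset.sum_congr rfl fun i hi => if_neg (Finset.mem_Ico.1 hi).1.not_gt
  rw [this]; ring

/-- **Lévy's maximal inequality** on the space of increments. If `k` is the first index at which
the partial sum exceeds `r`, then reversing the signs of the later increments reflects the final sum
`S N` in the sum `S k`, and one of the two reflected values exceeds `r` as well. -/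
theorem measure_exists_lt_abs_sum_le {Q : Measure (ℕ → ℝ)}
    (hQ : ∀ k, MeasurePreserving (flipFrom k) Q Q) (r : ℝ) (N : ℕ) :
    Q {v | ∃ k ≤ N, r < |∑ i ∈ Finset.range k, v i|}
      ≤ 2 * Q {v | r < |∑ i ∈ Finset.range N, v i|} := by
  classical
  have hSm : ∀ k : ℕ, Measurable fun v : ℕ → ℝ => |∑ i ∈ Finset.range k, v i| := fun k =>
    (Finset.measurable_sum _ fun i _ => measurable_pi_apply i).abs
  let A : ℕ → Set (ℕ → ℝ) := fun k =>
    {v | r < |∑ i ∈ Finset.range k, v i|} ∩ ⋂ j ∈ Finset.range k, {v | |∑ i ∈ Finset.range j, v i| ≤ r}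
  let B : Set (ℕ → ℝ) := {v | r < |∑ i ∈ Finset.range N, v i|}
  have hA : ∀ k, MeasurableSet (A k) := fun k =>
    (measurableSet_lt measurable_const (hSm k)).inter
      (Finset.measurableSet_biInter _ fun j _ => measurableSet_le (hSm j) measurable_const)
  have hB : MeasurableSet B := measurableSet_lt measurable_const (hSm N)
  have hmem : ∀ k v, v ∈ A k ↔ r < |∑ i ∈ Finset.range k, v i| ∧
      ∀ j < k, |∑ i ∈ Finset.range j, v i| ≤ r := fun k v => by simp [A]
  have hdisj : ∀ j k, j < k → Disjoint (A j) (A k) := fun j k hjk =>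
    Set.disjoint_left.2 fun v hj hk =>
      (((hmem j v).1 hj).1.trans_le (((hmem k v).1 hk).2 j hjk)).false
  have hcover : {v : ℕ → ℝ | ∃ k ≤ N, r < |∑ i ∈ Finset.range k, v i|}
      ⊆ ⋃ k ∈ Finset.range (N + 1), A k := by
    rintro v ⟨k, hkN, hk⟩
    have hex : ∃ k, r < |∑ i ∈ Finset.range k, v i| := ⟨k, hk⟩
    refine Set.mem_biUnion (x := Nat.find hex) ?_ ?_
    · exact Finset.mem_range.2 (Nat.lt_succ_of_le ((Nat.find_min' hex hk).trans hkN))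
    · exact (hmem _ v).2 ⟨Nat.find_spec hex, fun j hj => not_lt.1 (Nat.find_min hex hj)⟩
  have hAk : ∀ k ∈ Finset.range (N + 1), Q (A k) ≤ 2 * Q (A k ∩ B) := by
    intro k hk
    have hkN : k ≤ N := Nat.lt_succ_iff.1 (Finset.mem_range.1 hk)
    have hpre : flipFrom k ⁻¹' (A k ∩ B) = A k ∩ flipFrom k ⁻¹' B := by
      ext v
      rw [Set.preimage_inter, Set.mem_inter_iff, Set.mem_inter_iff, Set.mem_preimage, hmem, hmem,
        sum_flipFrom_of_le le_rfl]
      have : (∀ j < k, |∑ i ∈ Finset.range j, flipFrom k v i| ≤ r)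
          ↔ ∀ j < k, |∑ i ∈ Finset.range j, v i| ≤ r :=
        forall₂_congr fun j hj => by rw [sum_flipFrom_of_le hj.le]
      rw [this]
    have hsub : A k ⊆ (A k ∩ B) ∪ (flipFrom k ⁻¹' (A k ∩ B)) := by
      intro v hv
      by_cases hvB : v ∈ B
      · exact Or.inl ⟨hv, hvB⟩
      · refine Or.inr ?_
        rw [hpre]
        refine ⟨hv, ?_⟩
        have h1 := ((hmem k v).1 hv).1
        have h2 : |∑ i ∈ Finset.range N, v i| ≤ r := not_lt.1 hvB
        change r < |∑ i ∈ Finset.range N, flipFrom k v i|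
        rw [sum_flipFrom_of_ge hkN]
        have h3 := abs_sub_abs_le_abs_sub (2 * ∑ i ∈ Finset.range k, v i) (∑ i ∈ Finset.range N, v i)
        rw [abs_mul, abs_two] at h3
        linarith
    calc Q (A k) ≤ Q (A k ∩ B) + Q (flipFrom k ⁻¹' (A k ∩ B)) :=
          (measure_mono hsub).trans (measure_union_le _ _)
      _ = 2 * Q (A k ∩ B) := by
          rw [(hQ k).measure_preimage ((hA k).inter hB).nullMeasurableSet, two_mul]
  calc Q {v | ∃ k ≤ N, r < |∑ i ∈ Finset.range k, v i|}
      ≤ ∑ k ∈ Finset.range (N + 1), Q (A k) :=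
        (measure_mono hcover).trans (measure_biUnion_finset_le _ _)
    _ ≤ ∑ k ∈ Finset.range (N + 1), 2 * Q (A k ∩ B) := Finset.sum_le_sum hAk
    _ = 2 * Q (⋃ k ∈ Finset.range (N + 1), A k ∩ B) := by
        rw [← Finset.mul_sum, measure_biUnion_finset _ fun k _ => (hA k).inter hB]
        intro j _ k _ hjk
        refine Disjoint.mono Set.inter_subset_left Set.inter_subset_left ?_
        rcases hjk.lt_or_gt with h | h
        · exact hdisj j k h
        · exact (hdisj k j h).symm
    _ ≤ 2 * Q B := by
        gcongr
        exact Set.iUnion₂_subset fun k _ => Set.inter_subset_right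

theorem lt_min_sq_one_iff {b r x : ℝ} (hb : 0 < b) (hr : r < 1) (hr0 : 0 < r) :
    r < min ((b * x) ^ 2) 1 ↔ Real.sqrt r / b < |x| := by
  rw [lt_min_iff, and_iff_left hr, div_lt_iff₀ hb, mul_comm |x|, ← abs_of_pos hb, ← abs_mul,
    abs_of_pos hb, ← sq_abs (b * x), Real.sqrt_lt hr0.le (abs_nonneg _)]

/-- The `k`-th point of the `m`-th dyadic subdivision of `[0, t]`. -/
noncomputable def dyadicTime (t : ℝ≥0) (m k : ℕ) : ℝ≥0 := t * k / 2 ^ m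

theorem dyadicTime_monotone (t : ℝ≥0) (m : ℕ) : Monotone (dyadicTime t m) := fun i j h => by
  unfold dyadicTime; gcongr

theorem dyadicTime_succ (t : ℝ≥0) (m k : ℕ) : dyadicTime t (m + 1) (2 * k) = dyadicTime t m k := by
  unfold dyadicTime
  rw [pow_succ, Nat.cast_mul, Nat.cast_ofNat, show t * (2 * (k : ℝ≥0)) = t * k * 2 by ring,
    mul_div_mul_right _ _ two_ne_zero]

theorem dyadicTime_last (t : ℝ≥0) (m : ℕ) : dyadicTime t m (2 ^ m) = t := by
  unfold dyadicTime
  rw [Nat.cast_pow, Nat.cast_ofNat, mul_div_assoc, div_self (by positivity), mul_one]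

section DyadicSup

variable {Ω : Type*}

/-- The supremum of `min ((b Xₛ)², 1)` over the dyadic points `s` of `[0, t]`. -/
noncomputable def truncSup (X : ℝ≥0 → Ω → ℝ) (b : ℝ) (t : ℝ≥0) (ω : Ω) : ℝ :=
  ⨆ p : ℕ × ℕ, if p.2 ≤ 2 ^ p.1 then min ((b * X (dyadicTime t p.1 p.2) ω) ^ 2) 1 else 0

theorem bddAbove_range_truncSup (X : ℝ≥0 → Ω → ℝ) (b : ℝ) (t : ℝ≥0) (ω : Ω) :
    BddAbove (Set.range fun p : ℕ × ℕ =>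
      if p.2 ≤ 2 ^ p.1 then min ((b * X (dyadicTime t p.1 p.2) ω) ^ 2) 1 else 0) := by
  refine ⟨1, ?_⟩
  rintro _ ⟨p, rfl⟩
  dsimp only
  split_ifs
  · exact min_le_right _ _
  · exact zero_le_one

theorem truncSup_nonneg (X : ℝ≥0 → Ω → ℝ) (b : ℝ) (t : ℝ≥0) (ω : Ω) : 0 ≤ truncSup X b t ω := by
  refine Real.iSup_nonneg fun p => ?_
  split_ifs <;> positivity

theorem measurable_truncSup [MeasurableSpace Ω] {X : ℝ≥0 → Ω → ℝ} (hX : ∀ t, Measurable (X t)) (b : ℝ) (t : ℝ≥0) :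
    Measurable (truncSup X b t) := by
  refine Measurable.iSup fun p => ?_
  split_ifs
  · exact (((hX _).const_mul b).pow_const 2).min measurable_const
  · exact measurable_const

theorem le_truncSup (X : ℝ≥0 → Ω → ℝ) (b : ℝ) (t : ℝ≥0) (ω : Ω) {m k : ℕ} (hk : k ≤ 2 ^ m) :
    min ((b * X (dyadicTime t m k) ω) ^ 2) 1 ≤ truncSup X b t ω := by
  have := le_ciSup (bddAbove_range_truncSup X b t ω) (m, k)
  simp only [hk, if_true] at this
  exact this

/-- By right continuity the supremum over dyadic points bounds the whole path. -/
theorem IsCadlagPath.min_sq_one_le_truncSup {X : ℝ≥0 → Ω → ℝ} {ω : Ω}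
    (hω : IsCadlagPath fun t => X t ω) (b : ℝ) {s t : ℝ≥0} (hst : s ≤ t) :
    min ((b * X s ω) ^ 2) 1 ≤ truncSup X b t ω := by
  rcases hst.eq_or_lt with rfl | hlt
  · simpa only [dyadicTime_last] using le_truncSup X b s ω (m := 0) (k := 2 ^ 0) le_rfl
  have ht : 0 < t := pos_of_gt hlt
  -- `k m / 2 ^ m` is the first dyadic fraction of level `m` strictly above `s / t`.
  let k : ℕ → ℕ := fun m => ⌊s * 2 ^ m / t⌋₊ + 1
  have hk : ∀ m, k m ≤ 2 ^ m := fun m => by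
    have h1 : s * 2 ^ m / t < 2 ^ m := by
      rw [div_lt_iff₀ ht, mul_comm]
      gcongr
    have h2 : ⌊s * 2 ^ m / t⌋₊ < 2 ^ m := (Nat.floor_lt (by positivity)).2 (by exact_mod_cast h1)
    exact h2
  have hlow : ∀ m, s ≤ dyadicTime t m (k m) := fun m => by
    have h1 := (Nat.lt_floor_add_one (s * 2 ^ m / t)).le
    rw [div_le_iff₀ ht] at h1
    unfold dyadicTime
    rw [le_div_iff₀ (by positivity), mul_comm t]
    simpa [k] using h1
  have hupp : ∀ m, dyadicTime t m (k m) ≤ s + t * (1 / 2) ^ m := fun m => by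
    have h1 := Nat.floor_le (show 0 ≤ s * 2 ^ m / t by positivity)
    rw [le_div_iff₀ ht] at h1
    unfold dyadicTime
    rw [div_le_iff₀ (by positivity), add_mul, mul_assoc t, ← mul_pow]
    simp only [k, Nat.cast_add, Nat.cast_one]
    norm_num
    rw [mul_add, mul_one, mul_comm t]
    exact add_le_add_left h1 t
  have hlim : Tendsto (fun m => dyadicTime t m (k m)) atTop (𝓝[≥] s) := by
    refine tendsto_nhdsWithin_iff.2 ⟨?_, Eventually.of_forall hlow⟩
    refine tendsto_of_tendsto_of_tendsto_of_le_of_le tendsto_const_nhds ?_ hlow hupp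
    have := (NNReal.tendsto_pow_atTop_nhds_zero_of_lt_one
      (NNReal.half_lt_self one_ne_zero)).const_mul t
    simpa using this.const_add s
  have hcont : Tendsto (fun m => min ((b * X (dyadicTime t m (k m)) ω) ^ 2) 1) atTop
      (𝓝 (min ((b * X s ω) ^ 2) 1)) :=
    ((((hω s).1.tendsto.comp hlim).const_mul b).pow 2).min tendsto_const_nhds
  exact le_of_tendsto' hcont fun m => le_truncSup X b t ω (hk m)

end DyadicSup

section Maximal

variable {Ω : Type*} [MeasurableSpace Ω] {P : Measure Ω}

theorem measurePreserving_flipFrom_of_iIndepFun {X : ℕ → Ω → ℝ} (hind : iIndepFun X P)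
    (hsymm : ∀ i, IdentDistrib (X i) (fun ω => -X i ω) P P) (k : ℕ) :
    MeasurePreserving (flipFrom k) (P.map fun ω i => X i ω) (P.map fun ω i => X i ω) := by
  refine ⟨measurable_flipFrom k, ?_⟩
  have hflip : iIndepFun (fun i ω => flipFrom k (fun j => X j ω) i) P := by
    have := hind.comp (fun i x => if i < k then x else -x) fun i => by split_ifs <;> fun_prop
    exact this
  have hid : IdentDistrib (fun ω i => X i ω) (fun ω => flipFrom k fun j => X j ω) P P := by
    refine IdentDistrib.pi (fun i => ?_) hind hflip
    unfold flipFrom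
    split_ifs
    · exact IdentDistrib.refl (hsymm i).aemeasurable_fst
    · exact hsymm i
  rw [AEMeasurable.map_map_of_aemeasurable (measurable_flipFrom k).aemeasurable
    hid.aemeasurable_fst]
  exact hid.map_eq.symm

theorem IsLevyProcess.identDistrib_neg_increment {X : ℝ≥0 → Ω → ℝ} (hX : IsLevyProcess X P)
    (hsymm : ∀ t, IdentDistrib (X t) (fun ω => -X t ω) P P) {s t : ℝ≥0} (hst : s ≤ t) :
    IdentDistrib (fun ω => X t ω - X s ω) (fun ω => -(X t ω - X s ω)) P P := by
  obtain ⟨u, rfl⟩ := exists_add_of_le hst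
  have h0 : IdentDistrib (fun ω => X u ω - X 0 ω) (X u) P P :=
    IdentDistrib.of_ae_eq ((hX.measurable u).sub (hX.measurable 0)).aemeasurable (by
      filter_upwards [hX.start_zero] with ω hω
      simp [hω])
  have h1 := (hX.stationary_increments s u).trans h0
  exact (h1.trans (hsymm u)).trans (h1.comp measurable_neg).symm

/-- Lévy's maximal inequality along a finite sequence of times. -/
theorem IsLevyProcess.measure_exists_lt_abs_le {X : ℝ≥0 → Ω → ℝ} (hX : IsLevyProcess X P)
    (hsymm : ∀ t, IdentDistrib (X t) (fun ω => -X t ω) P P) {τ : ℕ → ℝ≥0} (hτ : Monotone τ)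
    (hτ0 : τ 0 = 0) (r : ℝ) (N : ℕ) :
    P {ω | ∃ k ≤ N, r < |X (τ k) ω|} ≤ 2 * P {ω | r < |X (τ N) ω|} := by
  let V : Ω → ℕ → ℝ := fun ω i => X (τ (i + 1)) ω - X (τ i) ω
  have hV : Measurable V := measurable_pi_lambda _ fun i => (hX.measurable _).sub (hX.measurable _)
  have hsum : ∀ ω k, ∑ i ∈ Finset.range k, V ω i = X (τ k) ω - X 0 ω := fun ω k => by
    rw [← hτ0]; exact Finset.sum_range_sub (fun i => X (τ i) ω) k
  have hSm : ∀ k : ℕ, Measurable fun v : ℕ → ℝ => |∑ i ∈ Finset.range k, v i| := fun k =>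
    (Finset.measurable_sum _ fun i _ => measurable_pi_apply i).abs
  have hS : ∀ k, MeasurableSet {v : ℕ → ℝ | r < |∑ i ∈ Finset.range k, v i|} := fun k =>
    measurableSet_lt measurable_const (hSm k)
  have hE : MeasurableSet {v : ℕ → ℝ | ∃ k ≤ N, r < |∑ i ∈ Finset.range k, v i|} := by
    have : {v : ℕ → ℝ | ∃ k ≤ N, r < |∑ i ∈ Finset.range k, v i|}
        = ⋃ k, ⋃ (_ : k ≤ N), {v | r < |∑ i ∈ Finset.range k, v i|} := by ext v; simp
    rw [this]
    exact .iUnion fun k => .iUnion fun _ => hS k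
  have h := measure_exists_lt_abs_sum_le (Q := P.map V)
    (measurePreserving_flipFrom_of_iIndepFun (hX.indep_increments.nat hτ)
      fun i => hX.identDistrib_neg_increment hsymm (hτ i.le_succ)) r N
  rw [Measure.map_apply hV hE, Measure.map_apply hV (hS N)] at h
  simp only [Set.preimage_ofPred_eq, hsum] at h
  convert h using 1
  · refine measure_congr ?_
    filter_upwards [hX.start_zero] with ω hω
    change (∃ k ≤ N, r < |X (τ k) ω|) = ∃ k ≤ N, r < |X (τ k) ω - X 0 ω|
    simp only [hω, sub_zero]
  · congr 1
    refine measure_congr ?_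
    filter_upwards [hX.start_zero] with ω hω
    change (r < |X (τ N) ω|) = (r < |X (τ N) ω - X 0 ω|)
    rw [hω, sub_zero]

/-- The mean of the truncated supremum is at most twice that of the value at the final time: this is
Lévy's maximal inequality integrated over the levels `r`, with the dyadic subdivisions exhausted. -/
theorem IsLevyProcess.lintegral_truncSup_le {X : ℝ≥0 → Ω → ℝ} (hX : IsLevyProcess X P)
    (hsymm : ∀ t, IdentDistrib (X t) (fun ω => -X t ω) P P) {b : ℝ} (hb : 0 < b) (t : ℝ≥0) :
    ∫⁻ ω, ENNReal.ofReal (truncSup X b t ω) ∂P ≤ 2 * truncMoment (P.map (X t)) b := by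
  rw [truncMoment, lintegral_map (by fun_prop) (hX.measurable t),
    lintegral_eq_lintegral_meas_lt P (ae_of_all _ fun ω => truncSup_nonneg X b t ω)
      (measurable_truncSup hX.measurable b t).aemeasurable,
    lintegral_eq_lintegral_meas_lt P (ae_of_all _ fun ω => by positivity)
      ((((hX.measurable t).const_mul b).pow_const 2).min measurable_const).aemeasurable,
    ← lintegral_const_mul' _ _ (by norm_num)]
  refine setLIntegral_mono' measurableSet_Ioi fun r (hr : 0 < r) => ?_
  let E : ℕ → Set Ω := fun m => {ω | ∃ k ≤ 2 ^ m, r < min ((b * X (dyadicTime t m k) ω) ^ 2) 1}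
  have hE : {ω | r < truncSup X b t ω} ⊆ ⋃ m, E m := by
    intro ω hω
    obtain ⟨p, hp⟩ := (lt_ciSup_iff (bddAbove_range_truncSup X b t ω)).1
      (show r < ⨆ p : ℕ × ℕ, _ from hω)
    split_ifs at hp with hle
    · exact Set.mem_iUnion.2 ⟨p.1, p.2, hle, hp⟩
    · exact absurd hp hr.not_gt
  have hmono : Monotone E := monotone_nat_of_le_succ fun m ω ⟨k, hk, h⟩ =>
    ⟨2 * k, by rw [pow_succ, mul_comm]; exact Nat.mul_le_mul_right 2 hk, by rwa [dyadicTime_succ]⟩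
  refine (measure_mono hE).trans ?_
  rw [hmono.measure_iUnion]
  refine iSup_le fun m => ?_
  rcases lt_or_ge r 1 with hr1 | hr1
  · have h := hX.measure_exists_lt_abs_le hsymm (dyadicTime_monotone t m)
      (by simp [dyadicTime]) (Real.sqrt r / b) (2 ^ m)
    simpa only [E, lt_min_sq_one_iff hb hr1 hr, dyadicTime_last] using h
  · have : E m = ∅ := by
      refine Set.eq_empty_of_forall_notMem ?_
      rintro ω ⟨k, -, h⟩
      exact (h.trans_le (min_le_right _ _)).not_ge hr1
    rw [this, measure_empty]
    exact zero_le

end Maximal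

/-! ### Independence of rows and columns -/

/-- If the rows of an array of random variables are independent, and each row consists of
independent variables, then the columns are independent as well. -/
theorem iIndepFun_transpose {Ω ι κ E : Type*} [MeasurableSpace Ω] [MeasurableSpace E]
    {P : Measure Ω} {X : ι → κ → Ω → E} (mX : ∀ i j, Measurable (X i j))
    (h1 : iIndepFun (fun i ω j => X i j ω) P) (h2 : ∀ i, iIndepFun (X i) P) :
    iIndepFun (fun j ω i => X i j ω) P := by
  have := h1.isProbabilityMeasure
  have hpair : iIndepFun (fun (p : κ × ι) ω => X p.2 p.1 ω) P :=
    (iIndepFun_uncurry' mX h1 h2).precomp Prod.swap_injective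
  have hprob : ∀ j i, IsProbabilityMeasure (P.map (X i j)) := fun j i =>
    Measure.isProbabilityMeasure_map (mX i j).aemeasurable
  have hlaw := (iIndepFun_iff_map_fun_eq_infinitePi_map fun p : κ × ι => mX p.2 p.1).1 hpair
  rw [iIndepFun_iff_map_fun_eq_infinitePi_map fun j => measurable_pi_lambda _ fun i => mX i j]
  have hcomp : (fun ω j i => X i j ω)
      = (MeasurableEquiv.curry κ ι E) ∘ fun ω (p : κ × ι) => X p.2 p.1 ω := rfl
  rw [hcomp, ← Measure.map_map (MeasurableEquiv.measurable _)
    (measurable_pi_lambda _ fun p : κ × ι => mX p.2 p.1), hlaw,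
    Measure.infinitePi_map_curry fun j i => P.map (X i j)]
  congr with j : 1
  have hcol : iIndepFun (fun i => X i j) P :=
    hpair.precomp (g := fun i => (j, i)) fun a b h => (Prod.mk.inj h).2
  exact ((iIndepFun_iff_map_fun_eq_infinitePi_map fun i => mX i j).1 hcol).symm

/-! ### Convergence and measurability in the weighted sequence space -/

namespace WeightedL2

variable {ρ : PosWeight}

/-- The element of `l²_ρ` given by a sequence with `∑ xₙ² ρₙ² < ∞`. -/
noncomputable def ofSummable (x : ℕ → ℝ) (h : Summable fun n => x n ^ 2 * ρ.1 n ^ 2) : WeightedL2 ρ :=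
  (⟨x, h⟩ : weightedL2Submodule ρ.1)

open Classical in
/-- The element of `l²_ρ` with the given coordinates; a sequence outside `l²_ρ` is sent to `0`, so
that the map is defined, and measurable, on the space of all sequences. -/
noncomputable def ofSeq (ρ : PosWeight) (x : ℕ → ℝ) : WeightedL2 ρ :=
  if h : Summable fun n => x n ^ 2 * ρ.1 n ^ 2 then ofSummable x h else 0

theorem coord_ofSeq {x : ℕ → ℝ} (h : Summable fun n => x n ^ 2 * ρ.1 n ^ 2) (n : ℕ) :
    (ofSeq ρ x).coord n = x n := by
  rw [ofSeq, dif_pos h]; rfl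

theorem coord_zero (n : ℕ) : (0 : WeightedL2 ρ).coord n = 0 := rfl

theorem coord_sub (x y : WeightedL2 ρ) (n : ℕ) : (x - y).coord n = x.coord n - y.coord n := rfl

theorem coord_sum {ι : Type*} (s : Finset ι) (f : ι → WeightedL2 ρ) (n : ℕ) :
    (∑ i ∈ s, f i).coord n = ∑ i ∈ s, (f i).coord n := by
  classical
  induction s using Finset.induction_on with
  | empty => simp [coord_zero]
  | insert i s hi ih => rw [Finset.sum_insert hi, Finset.sum_insert hi, coord_add, ih]

theorem norm_sq_eq_tsum (x : WeightedL2 ρ) : ‖x‖ ^ 2 = ∑' n, x.coord n ^ 2 * ρ.1 n ^ 2 := by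
  rw [← real_inner_self_eq_norm_sq]
  change ∑' n, x.coord n * x.coord n * ρ.1 n ^ 2 = _
  exact tsum_congr fun n => by ring

theorem ofSeq_sub {x y : ℕ → ℝ} (hx : Summable fun n => x n ^ 2 * ρ.1 n ^ 2)
    (hy : Summable fun n => y n ^ 2 * ρ.1 n ^ 2) :
    ofSeq ρ x - ofSeq ρ y = ofSeq ρ fun n => x n - y n := by
  have h : Summable fun n => (x n - y n) ^ 2 * ρ.1 n ^ 2 :=
    (weightedL2Submodule ρ.1).sub_mem (x := x) (y := y) hx hy
  exact coord_ext fun n => by rw [coord_sub, coord_ofSeq hx, coord_ofSeq hy, coord_ofSeq h]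

/-- Dominated convergence in `l²_ρ`. -/
theorem tendsto_of_dominated {α : Type*} {l : Filter α} {f : α → WeightedL2 ρ} {y : WeightedL2 ρ}
    {bound : ℕ → ℝ} (hb : Summable bound)
    (hlim : ∀ n, Tendsto (fun s => (f s).coord n) l (𝓝 (y.coord n)))
    (hdom : ∀ᶠ s in l, ∀ n, ((f s).coord n - y.coord n) ^ 2 * ρ.1 n ^ 2 ≤ bound n) :
    Tendsto f l (𝓝 y) := by
  rw [tendsto_iff_norm_sub_tendsto_zero]
  have hsq : Tendsto (fun s => ‖f s - y‖ ^ 2) l (𝓝 0) := by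
    simp only [norm_sq_eq_tsum, coord_sub]
    have := tendsto_tsum_of_dominated_convergence (𝓕 := l)
      (f := fun s n => ((f s).coord n - y.coord n) ^ 2 * ρ.1 n ^ 2) (g := fun _ => 0) hb
      (fun n => by simpa using (((hlim n).sub_const (y.coord n)).pow 2).mul_const (ρ.1 n ^ 2))
      (hdom.mono fun s hs n => by
        rw [Real.norm_of_nonneg (by positivity)]; exact hs n)
    simpa using this
  have := (Real.continuous_sqrt.tendsto 0).comp hsq
  simpa [Function.comp_def, Real.sqrt_sq (norm_nonneg _)] using this

theorem summable_single (n : ℕ) :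
    Summable fun m => (Pi.single n (1 : ℝ) : ℕ → ℝ) m ^ 2 * ρ.1 m ^ 2 :=
  summable_of_ne_finset_zero (s := {n}) fun m hm => by
    rw [Pi.single_eq_of_ne (by simpa using hm)]; simp

theorem coord_sum_smul_single (x : ℕ → ℝ) (N m : ℕ) :
    (∑ n ∈ Finset.range N, x n • ofSeq ρ (Pi.single n 1)).coord m = if m < N then x m else 0 := by
  simp only [coord_sum, coord_smul, coord_ofSeq (summable_single _), Pi.single_apply]
  simp

theorem measurableSet_summable (ρ : PosWeight) :
    MeasurableSet {x : ℕ → ℝ | Summable fun n => x n ^ 2 * ρ.1 n ^ 2} := by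
  have : {x : ℕ → ℝ | Summable fun n => x n ^ 2 * ρ.1 n ^ 2}
      = {x | ∑' n, ENNReal.ofReal (x n ^ 2 * ρ.1 n ^ 2) < ⊤} := by
    ext x
    refine ⟨fun h => h.tsum_ofReal_lt_top, fun h => ?_⟩
    have := ENNReal.summable_toReal (ne_of_lt h)
    exact this.congr fun n => ENNReal.toReal_ofReal (by positivity)
  rw [this]
  exact measurableSet_lt (by fun_prop) measurable_const

theorem measurable_ofSeq (ρ : PosWeight) : Measurable (ofSeq ρ) := by
  classical
  let S : Set (ℕ → ℝ) := {x | Summable fun n => x n ^ 2 * ρ.1 n ^ 2}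
  let F : ℕ → (ℕ → ℝ) → WeightedL2 ρ := fun N x =>
    ∑ n ∈ Finset.range N, x n • ofSeq ρ (Pi.single n 1)
  have hF : ∀ N, Measurable (F N) := fun N =>
    (continuous_finsetSum _ fun n _ => (continuous_apply n).smul continuous_const).measurable
  refine measurable_of_tendsto_metrizable (f := fun N => S.indicator (F N))
    (fun N => (hF N).indicator (measurableSet_summable ρ)) (tendsto_pi_nhds.2 fun x => ?_)
  by_cases hx : x ∈ S
  · simp only [Set.indicator_of_mem hx]
    refine tendsto_of_dominated (bound := fun n => x n ^ 2 * ρ.1 n ^ 2) hx (fun n => ?_)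
      (Eventually.of_forall fun N n => ?_)
    · rw [coord_ofSeq hx]
      refine tendsto_const_nhds.congr' ?_
      filter_upwards [eventually_gt_atTop n] with N hN
      rw [coord_sum_smul_single, if_pos hN]
    · rw [coord_ofSeq hx, coord_sum_smul_single]
      split_ifs
      · simpa using mul_nonneg (sq_nonneg (x n)) (sq_nonneg (ρ.1 n))
      · simp
  · simp only [Set.indicator_of_notMem hx]
    rw [ofSeq, dif_neg (show ¬ Summable _ from hx)]
    exact tendsto_const_nhds

theorem summable_of_min_le {x M : ℕ → ℝ} (hM : Summable M)
    (hx : ∀ n, min ((ρ.1 n * x n) ^ 2) 1 ≤ M n) : Summable fun n => x n ^ 2 * ρ.1 n ^ 2 := by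
  have h := summable_of_summable_min_one (x := fun n => (ρ.1 n * x n) ^ 2) (fun n => sq_nonneg _)
    (hM.of_nonneg_of_le (fun n => by positivity) hx)
  exact h.congr fun n => by ring

/-- Coordinatewise convergence is convergence in `l²_ρ`, provided that the truncated squares of the
coordinates stay below a summable sequence `M`. All but finitely many `M n` are below `1`, and there
the truncation has no effect; the other coordinates are eventually close to their limits. -/
theorem tendsto_ofSeq {α : Type*} {l : Filter α} {x : α → ℕ → ℝ} {y : ℕ → ℝ} {M : ℕ → ℝ}
    (hM : Summable M) (hlim : ∀ n, Tendsto (fun s => x s n) l (𝓝 (y n)))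
    (hx : ∀ᶠ s in l, ∀ n, min ((ρ.1 n * x s n) ^ 2) 1 ≤ M n) :
    Tendsto (fun s => ofSeq ρ (x s)) l (𝓝 (ofSeq ρ y)) := by
  rcases l.eq_or_neBot with rfl | hl
  · exact tendsto_bot
  have hy : ∀ n, min ((ρ.1 n * y n) ^ 2) 1 ≤ M n := fun n =>
    le_of_tendsto ((((hlim n).const_mul (ρ.1 n)).pow 2).min tendsto_const_nhds)
      (hx.mono fun s hs => hs n)
  have hys := summable_of_min_le hM hy
  have hxs : ∀ᶠ s in l, Summable fun n => x s n ^ 2 * ρ.1 n ^ 2 :=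
    hx.mono fun s hs => summable_of_min_le hM hs
  obtain ⟨n₀, hn₀⟩ := eventually_atTop.1 (hM.tendsto_atTop_zero.eventually_lt_const one_pos)
  have hle : ∀ {z : ℝ} {n : ℕ}, n₀ ≤ n → min ((ρ.1 n * z) ^ 2) 1 ≤ M n → (ρ.1 n * z) ^ 2 ≤ M n :=
    fun {z n} hn h => (min_le_iff.1 h).resolve_right (hn₀ n hn).not_ge
  have hsmall : ∀ᶠ s in l, ∀ n ∈ Finset.range n₀, (x s n - y n) ^ 2 * ρ.1 n ^ 2 ≤ 1 := by
    refine (Finset.eventually_all _).2 fun n _ => ?_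
    have : Tendsto (fun s => (x s n - y n) ^ 2 * ρ.1 n ^ 2) l (𝓝 0) := by
      simpa using (((hlim n).sub_const (y n)).pow 2).mul_const (ρ.1 n ^ 2)
    exact this.eventually_le_const one_pos
  have hbs : Summable fun n => 4 * M n + if n < n₀ then (1 : ℝ) else 0 :=
    (hM.mul_left 4).add (summable_of_ne_finset_zero (s := Finset.range n₀) fun n hn =>
      if_neg (by simpa using hn))
  refine tendsto_of_dominated hbs (fun n => ?_) ?_
  · rw [coord_ofSeq hys]
    exact (hlim n).congr' (hxs.mono fun s hs => (coord_ofSeq hs n).symm)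
  · filter_upwards [hx, hxs, hsmall] with s hs hss hsm n
    rw [coord_ofSeq hys, coord_ofSeq hss]
    split_ifs with hn
    · have h0 : 0 ≤ M n := (show 0 ≤ min ((ρ.1 n * y n) ^ 2) 1 by positivity).trans (hy n)
      linarith [hsm n (Finset.mem_range.2 hn)]
    · have h1 := hle (not_lt.1 hn) (hs n)
      have h2 := hle (not_lt.1 hn) (hy n)
      nlinarith [sq_nonneg (ρ.1 n * x s n + ρ.1 n * y n)]

theorem isCadlagPath_ofSeq {x : ℝ≥0 → ℕ → ℝ} (hcad : ∀ n, IsCadlagPath fun t => x t n)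
    (hdom : ∀ T : ℕ, ∃ M : ℕ → ℝ, Summable M ∧
      ∀ s : ℝ≥0, s ≤ T → ∀ n, min ((ρ.1 n * x s n) ^ 2) 1 ≤ M n) :
    IsCadlagPath fun t => ofSeq ρ (x t) := by
  intro t
  obtain ⟨T, hT⟩ := exists_nat_gt t
  obtain ⟨M, hM, hx⟩ := hdom T
  have hev : ∀ᶠ s in 𝓝 t, ∀ n, min ((ρ.1 n * x s n) ^ 2) 1 ≤ M n := by
    filter_upwards [Iio_mem_nhds hT] with s hs using hx s (le_of_lt hs)
  refine ⟨tendsto_ofSeq hM (fun n => (hcad n t).1) (nhdsWithin_le_nhds hev), ?_⟩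
  choose y hy using fun n => (hcad n t).2
  exact ⟨ofSeq ρ y, tendsto_ofSeq hM hy (nhdsWithin_le_nhds hev)⟩

end WeightedL2

/-! ### The equivalence and the process in the weighted sequence space -/

theorem truncMoment_map {Ω : Type*} [MeasurableSpace Ω] {P : Measure Ω} {X : Ω → ℝ} (hX : Measurable X) (b : ℝ) :
    truncMoment (P.map X) b = ∫⁻ ω, ENNReal.ofReal (min ((b * X ω) ^ 2) 1) ∂P := by
  rw [truncMoment, lintegral_map (by fun_prop) hX]

section Main

variable {Ω : Type*} [MeasurableSpace Ω] {P : Measure Ω} [IsProbabilityMeasure P]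
  {Z : ℕ → ℝ≥0 → Ω → ℝ} {β : ℕ → ℝ} {a : ℝ} {ν : Measure ℝ}

theorem tsum_truncMoment_map_lt_top (hβ : ∀ n, 0 < β n)
    (hX : ∀ n t, AEMeasurable (Z n t) P)
    (hsymm : ∀ n t, IdentDistrib (Z n t) (fun ω => -Z n t ω) P P)
    (htriplet : ∀ n, HasLevyTriplet (Z n) P 0 a ν) (h : truncatedMomentSum ν β < ⊤) (t : ℝ≥0) :
    ∑' n, truncMoment (P.map (Z n t)) (β n) < ⊤ := by
  rw [truncatedMomentSum_eq_tsum_truncMoment ν hβ] at h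
  calc ∑' n, truncMoment (P.map (Z n t)) (β n)
      ≤ ∑' n, 80 * t * truncMoment ν (β n) :=
        ENNReal.tsum_le_tsum fun n => (htriplet n).truncMoment_map_le (hX n) (hsymm n) t (hβ n)
    _ = 80 * t * ∑' n, truncMoment ν (β n) := ENNReal.tsum_mul_left
    _ < ⊤ := ENNReal.mul_lt_top (by finiteness) h

theorem ae_summable_sq_of_truncatedMomentSum_lt_top (hβ : ∀ n, 0 < β n)
    (hX : ∀ n t, Measurable (Z n t))
    (hsymm : ∀ n t, IdentDistrib (Z n t) (fun ω => -Z n t ω) P P)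
    (htriplet : ∀ n, HasLevyTriplet (Z n) P 0 a ν) (h : truncatedMomentSum ν β < ⊤) (t : ℝ≥0) :
    ∀ᵐ ω ∂P, Summable fun n => (β n * Z n t ω) ^ 2 := by
  have h1 := tsum_truncMoment_map_lt_top hβ (fun n t => (hX n t).aemeasurable) hsymm htriplet h t
  simp only [truncMoment_map (hX _ t)] at h1
  filter_upwards [ae_summable_of_tsum_lintegral_lt_top
    (fun n => ((((hX n t).const_mul (β n)).pow_const 2).min measurable_const).aemeasurable)
    (fun n ω => by positivity) h1] with ω hω
  exact summable_of_summable_min_one (fun n => sq_nonneg _) hω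

theorem truncatedMomentSum_lt_top_of_ae_summable_sq (hβ : ∀ n, 0 < β n)
    (hX : ∀ n t, Measurable (Z n t))
    (hindep : iIndepFun (fun (n : ℕ) (ω : Ω) (t : ℝ≥0) => Z n t ω) P)
    (hsymm : ∀ n t, IdentDistrib (Z n t) (fun ω => -Z n t ω) P P)
    (htriplet : ∀ n, HasLevyTriplet (Z n) P 0 a ν) {t : ℝ≥0} (ht : 0 < t)
    (h : ∀ᵐ ω ∂P, Summable fun n => (β n * Z n t ω) ^ 2) :
    truncatedMomentSum ν β < ⊤ := by
  rw [truncatedMomentSum_eq_tsum_truncMoment ν hβ]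
  have hind : iIndepFun (fun n ω => (β n * Z n t ω) ^ 2) P :=
    hindep.comp (fun n z => (β n * z t) ^ 2) fun n => by fun_prop
  have h1 := tsum_lintegral_min_one_lt_top_of_iIndepFun
    (fun n => ((hX n t).const_mul (β n)).pow_const 2) (fun n ω => sq_nonneg _) hind h
  simp only [← truncMoment_map (hX _ t)] at h1
  refine tsum_lt_top_of_le_mul ht 80 (fun n => (htriplet n).levyMeasure.truncMoment_lt_top _) h1
    fun n => ?_
  exact_mod_cast (htriplet n).truncMoment_le_map (fun t => (hX n t).aemeasurable) (hsymm n) t (hβ n)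

theorem IsLevyMeasure.exists_posWeight (hν : IsLevyMeasure ν) (hβ : ∀ n, 0 < β n) :
    ∃ ρ : PosWeight, truncatedMomentSum ν (fun n => ρ.1 n * β n) < ⊤ := by
  obtain ⟨ε, hε, hsum⟩ := ENNReal.exists_pos_sum_of_countable' one_ne_zero ℕ
  choose k hk using fun n =>
    (hν.tendsto_truncMoment.eventually_lt_const (hε n)).exists
  have hpos : ∀ n, 0 < 1 / ((k n : ℝ) + 1) := fun n => by positivity
  refine ⟨⟨fun n => 1 / ((k n : ℝ) + 1) / β n, fun n => div_pos (hpos n) (hβ n)⟩, ?_⟩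
  simp only [div_mul_cancel₀ _ (hβ _).ne']
  rw [truncatedMomentSum_eq_tsum_truncMoment ν hpos]
  exact (ENNReal.tsum_le_tsum fun n => (hk n).le).trans_lt (hsum.trans ENNReal.one_lt_top)

/-- Almost surely, on every bounded time interval, the truncated squares of the coordinates are
bounded uniformly in time by a summable sequence. -/
theorem ae_summable_truncSup {γ : ℕ → ℝ} (hγ : ∀ n, 0 < γ n) (hlevy : ∀ n, IsLevyProcess (Z n) P)
    (hsymm : ∀ n t, IdentDistrib (Z n t) (fun ω => -Z n t ω) P P)
    (htriplet : ∀ n, HasLevyTriplet (Z n) P 0 a ν) (h : truncatedMomentSum ν γ < ⊤) :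
    ∀ᵐ ω ∂P, ∀ T : ℕ, Summable fun n => truncSup (Z n) (γ n) T ω := by
  refine ae_all_iff.2 fun T => ?_
  refine ae_summable_of_tsum_lintegral_lt_top
    (fun n => (measurable_truncSup (hlevy n).measurable (γ n) T).aemeasurable)
    (fun n ω => truncSup_nonneg _ _ _ _) ?_
  calc ∑' n, ∫⁻ ω, ENNReal.ofReal (truncSup (Z n) (γ n) T ω) ∂P
      ≤ ∑' n, 2 * truncMoment (P.map (Z n T)) (γ n) :=
        ENNReal.tsum_le_tsum fun n => (hlevy n).lintegral_truncSup_le (hsymm n) (hγ n) T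
    _ = 2 * ∑' n, truncMoment (P.map (Z n T)) (γ n) := ENNReal.tsum_mul_left
    _ < ⊤ := ENNReal.mul_lt_top ENNReal.ofNat_lt_top
        (tsum_truncMoment_map_lt_top hγ (fun n t => ((hlevy n).measurable t).aemeasurable) hsymm
          htriplet h T)

/-- The sequence of processes, put into `l²_ρ` by `WeightedL2.ofSeq`, is a Lévy process there. Where
the sequence leaves `l²_ρ` the value is `0`, which keeps the process measurable for every `t`. -/
theorem exists_isLevyProcess_weightedL2 (hβ : ∀ n, 0 < β n)
    (hlevy : ∀ n, IsLevyProcess (Z n) P)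
    (hindep : iIndepFun (fun (n : ℕ) (ω : Ω) (t : ℝ≥0) => Z n t ω) P)
    (hsymm : ∀ n t, IdentDistrib (Z n t) (fun ω => -Z n t ω) P P)
    (htriplet : ∀ n, HasLevyTriplet (Z n) P 0 a ν) (ρ : PosWeight)
    (h : truncatedMomentSum ν (fun n => ρ.1 n * β n) < ⊤) :
    ∃ Y : ℝ≥0 → Ω → WeightedL2 ρ, IsLevyProcess Y P ∧
      ∀ᵐ ω ∂P, ∀ (t : ℝ≥0) (n : ℕ), (Y t ω).coord n = β n * Z n t ω := by
  have hZ : ∀ n t, Measurable (Z n t) := fun n => (hlevy n).measurable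
  let Φ : (ℕ → ℝ) → WeightedL2 ρ := fun v => WeightedL2.ofSeq ρ fun n => β n * v n
  have hΦ : Measurable Φ := (WeightedL2.measurable_ofSeq ρ).comp (by fun_prop)
  have hcad : ∀ᵐ ω ∂P, ∀ n, IsCadlagPath fun t => Z n t ω := ae_all_iff.2 fun n => (hlevy n).cadlag
  have hdom : ∀ᵐ ω ∂P, ∀ T : ℕ, ∃ M : ℕ → ℝ, Summable M ∧ ∀ s : ℝ≥0, s ≤ T → ∀ n,
      min ((ρ.1 n * (β n * Z n s ω)) ^ 2) 1 ≤ M n := by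
    filter_upwards [hcad, ae_summable_truncSup (fun n => mul_pos (ρ.2 n) (hβ n)) hlevy hsymm htriplet h]
      with ω hω hs T
    refine ⟨_, hs T, fun s hsT n => ?_⟩
    rw [← mul_assoc]
    exact (hω n).min_sq_one_le_truncSup _ hsT
  have hsum : ∀ᵐ ω ∂P, ∀ t, Summable fun n => (β n * Z n t ω) ^ 2 * ρ.1 n ^ 2 := by
    filter_upwards [hdom] with ω hω t
    obtain ⟨T, hT⟩ := exists_nat_ge t
    obtain ⟨M, hM, hx⟩ := hω T
    exact WeightedL2.summable_of_min_le hM (hx t hT)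
  have hincr : ∀ s t, (fun ω => Φ (fun n => Z n t ω) - Φ (fun n => Z n s ω))
      =ᵐ[P] fun ω => Φ fun n => Z n t ω - Z n s ω := fun s t => by
    filter_upwards [hsum] with ω hω
    simp only [Φ]
    rw [WeightedL2.ofSeq_sub (hω t) (hω s)]
    simp only [mul_sub]
  have hincrZ : ∀ s t, iIndepFun (fun n ω => Z n t ω - Z n s ω) P := fun s t =>
    hindep.comp (fun _ z => z t - z s) fun _ => by fun_prop
  have hincrm : ∀ s t, Measurable fun ω n => Z n t ω - Z n s ω := fun s t =>
    measurable_pi_lambda _ fun n => (hZ n t).sub (hZ n s)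
  refine ⟨fun t ω => Φ fun n => Z n t ω, ⟨fun t => ?_, ?_, ?_, fun s t => ?_, ?_⟩, ?_⟩
  · exact hΦ.comp (measurable_pi_lambda _ fun n => hZ n t)
  · filter_upwards [ae_all_iff.2 fun n => (hlevy n).start_zero] with ω hω
    refine WeightedL2.coord_ext fun n => ?_
    have h0 : Summable fun n => (β n * Z n 0 ω) ^ 2 * ρ.1 n ^ 2 := by simp [hω, summable_zero]
    simp only [Φ]
    rw [WeightedL2.coord_ofSeq h0, hω, mul_zero, WeightedL2.coord_zero]
  · intro k t ht
    have hcols : iIndepFun (fun (i : Fin k) ω n => Z n (t i.succ) ω - Z n (t i.castSucc) ω) P := by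
      refine iIndepFun_transpose (X := fun n (i : Fin k) ω => Z n (t i.succ) ω - Z n (t i.castSucc) ω)
        (fun n i => (hZ n _).sub (hZ n _)) ?_ fun n => (hlevy n).indep_increments k t ht
      exact hindep.comp (fun _ z (i : Fin k) => z (t i.succ) - z (t i.castSucc))
        fun _ => by fun_prop
    exact (hcols.comp (fun _ => Φ) fun _ => hΦ).congr fun i => (hincr _ _).symm
  · have hseq : IdentDistrib (fun ω n => Z n (s + t) ω - Z n s ω) (fun ω n => Z n t ω - Z n 0 ω) P P :=
      IdentDistrib.pi (fun n => (hlevy n).stationary_increments s t) (hincrZ _ _) (hincrZ _ _)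
    have h1 := IdentDistrib.of_ae_eq (hΦ.comp (hincrm s (s + t))).aemeasurable
      (hincr s (s + t)).symm
    have h2 := IdentDistrib.of_ae_eq (hΦ.comp (hincrm 0 t)).aemeasurable (hincr 0 t).symm
    exact (h1.symm.trans (hseq.comp hΦ)).trans h2
  · filter_upwards [hcad, hdom] with ω hω hd
    exact WeightedL2.isCadlagPath_ofSeq (fun n t => ⟨(hω n t).1.const_mul (β n),
      (hω n t).2.imp' (fun l => β n * l) fun l hl => hl.const_mul (β n)⟩) hd
  · filter_upwards [hsum] with ω hω t n
    exact WeightedL2.coord_ofSeq (hω t) n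

end Main

theorem proposition2p4 {Ω : Type*} [MeasurableSpace Ω] (P : Measure Ω) [IsProbabilityMeasure P]
    (Z : ℕ → ℝ≥0 → Ω → ℝ) (β : ℕ → ℝ) (a : ℝ) (ν : Measure ℝ)
    (hβ : ∀ n, 0 < β n)
    (hlevy : ∀ n, IsLevyProcess (Z n) P)
    (hindep : iIndepFun (fun (n : ℕ) (ω : Ω) (t : ℝ≥0) => Z n t ω) P)
    (hident : ∀ n m, IdentDistrib (fun (ω : Ω) (t : ℝ≥0) => Z n t ω)
      (fun (ω : Ω) (t : ℝ≥0) => Z m t ω) P P)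
    (hsymm : ∀ n t, IdentDistrib (Z n t) (fun ω => -Z n t ω) P P)
    (htriplet : ∀ n, HasLevyTriplet (Z n) P 0 a ν) :
    List.TFAE [
      ∃ t₀ : ℝ≥0, 0 < t₀ ∧ ∀ᵐ ω ∂P, Summable fun n => (β n * Z n t₀ ω) ^ 2,
      ∀ t : ℝ≥0, ∀ᵐ ω ∂P, Summable fun n => (β n * Z n t ω) ^ 2,
      truncatedMomentSum ν β < ⊤] ∧
    (∀ ρ : PosWeight, truncatedMomentSum ν (fun n => ρ.1 n * β n) < ⊤ →
      ∃ Y : ℝ≥0 → Ω → WeightedL2 ρ, IsLevyProcess Y P ∧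
        ∀ᵐ ω ∂P, ∀ (t : ℝ≥0) (n : ℕ), (Y t ω).coord n = β n * Z n t ω) ∧
    (∃ ρ : PosWeight, truncatedMomentSum ν (fun n => ρ.1 n * β n) < ⊤) := by
  refine ⟨?_, exists_isLevyProcess_weightedL2 hβ hlevy hindep hsymm htriplet,
    (htriplet 0).levyMeasure.exists_posWeight hβ⟩
  have hZ : ∀ n t, Measurable (Z n t) := fun n => (hlevy n).measurable
  tfae_have 2 → 1 := fun h => ⟨1, one_pos, h 1⟩
  tfae_have 1 → 3 := fun ⟨_, ht, h⟩ =>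
    truncatedMomentSum_lt_top_of_ae_summable_sq hβ hZ hindep hsymm htriplet ht h
  tfae_have 3 → 2 := ae_summable_sq_of_truncatedMomentSum_lt_top hβ hZ hsymm htriplet
  tfae_finish
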